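/- Let $\mathcal S$ be a finite set of subsystems and consider the strongly convex quadratic program $$\min_{(x_i)_{i\in\mathcal S},\,y}\ \sum_{i\in\mathcal S} f_i(x_i,y),\qquad f_i(x,y)=\tfrac12\begin{bmatrix}x\\y\end{bmatrix}^\top\begin{bmatrix}H_i^{xx}&H_i^{xy}\\H_i^{xy\top}&H_i^{yy}\end{bmatrix}\begin{bmatrix}x\\y\end{bmatrix}+\begin{bmatrix}h_i^x\\h_i^y\end{bmatrix}^\top\begin{bmatrix}x\\y\end{bmatrix},$$ subject to $A_i^xx_i+A_i^yy=b_i$ and $B_i^xx_i+B_i^yy\le d_i$ for $i\in\mathcal S$, and $A^yy=b^y$, $B^yy\le d^y$, with $x_i\in\mathbb R^{n_{xi}}$, $y\in\mathbb R^{n_y}$. Strong convexity means that the objective is a strongly convex function of all variables $((x_i)_{i\in\mathcal S},y)$. Assume for all $i\in\mathcal S$ that a) $\begin{bmatrix}\Delta x\\\Delta y\end{bmatrix}^\top\begin{bmatrix}H_i^{xx}&H_i^{xy}\\H_i^{xy\top}&H_i^{yy}\end{bmatrix}\begin{bmatrix}\Delta x\\\Delta y\end{bmatrix}>0$ for all $(\Delta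 x,\Delta y)\ne0$ with $A_i^x\Delta x+A_i^y\Delta y=0$; b) $\begin{bmatrix}A_i^x&A_i^y\\B_i^x&B_i^y\end{bmatrix}$ has full row rank. Fix parameters and let $\phi_i$, for all $i\in\mathcal S$, be either the augmented-Lagrangian relaxation $$\Phi_i^{\delta,\rho}(y)=\min_{x,s,z}\ f_i(x,y)+\lambda_i^\top(y-z)+\tfrac\rho2\|y-z\|_2^2-\delta\sum_j\ln s_j$$ subject to $A_i^xx+A_i^yz=b_i$, $B_i^xx+B_i^yz+s=d_i$, $s>0$, with $\delta,\rho>0$ and $\lambda_i\in\mathbb R^{n_y}$; or the $\ell_1$-relaxation $$\Phi_i^{\delta,\bar\lambda}(y)=\min_{x,s,z,v,w}\ f_i(x,z)+\bar\lambda\sum_j(v_j+w_j)-\delta\Big(\sum_j\ln s_j+\sum_j\ln v_j+\sum_j\ln w_j\Big)$$ subject to the same constraints and $y-z-v+w=0$, $v,w>0$, with $\delta,\bar\lambda>0$. Let $\psi=\sum_{i\in\mathcal S}\phi_i$, let $\mathcal Y=\{y: A^yy=b^y,\ B^yy\le d^y\}$ be non-empty, and let $\sigma,\zeta\in(0,1)$.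 The master problem is $\min_{y\in\mathcal Y}\psi(y)$. The solver starts at some $y^0\in\mathcal Y$. At an iterate $y$ it takes as search direction $\Delta y$ a solution of $$\min_{\Delta y}\ \sum_{i\in\mathcal S}\tfrac12\Delta y^\top\nabla^2\phi_i(y)\Delta y+\nabla\phi_i(y)^\top\Delta y\quad\text{s.t. } A^y(y+\Delta y)=b^y,\ B^y(y+\Delta y)\le d^y,$$ it stops and returns $y$ if $\Delta y=0$, and otherwise it starts with $\alpha=1$, replaces $\alpha$ by $\zeta\alpha$ as long as the Armijo condition $\psi(y)-\psi(y+\alpha\Delta y)\ge-\sigma\alpha\nabla\psi(y)^\top\Delta y$ fails, and then replaces $y$ by $y+\alpha\Delta y$. Then the minima defining $\phi_i(y)$ are attained for all $y\in\mathbb R^{n_y}$, each $\phi_i$ is twice continuously differentiable, and the master problem has exactly one global minimizer $y^\star$. At every $y\in\mathcal Y$ the search direction exists and is unique and the backtracking terminates. From every $y^0\in\mathcal Y$ the solver either stops after finitely many iterations and returns $y^\star$, or generates an infinite sequence of points of $\mathcal Y$ that converges to $y^\star$. -/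

import Mathlib

open Matrix Filter Topology

/-- Data of the partially separable quadratic program
`min ∑ i, 1/2 [x i; y]ᵀ [Hxx i, Hxy i; (Hxy i)ᵀ, Hyy i] [x i; y] + [hx i; hy i]ᵀ [x i; y]`
subject to `Ax i * x i + Ay i * y = b i`, `Bx i * x i + By i * y ≤ d i` for every subsystem `i`,
and `Ag * y = bg`, `Bg * y ≤ dg`. -/
structure NetworkQP (ι : Type*) (ny : ℕ) where
  /-- number of local variables -/
  nx : ι → ℕ
  /-- number of local equality constraints -/
  na : ι → ℕ
  /-- number of local inequality constraints -/
  nb : ι → ℕ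
  Hxx : (i : ι) → Matrix (Fin (nx i)) (Fin (nx i)) ℝ
  Hxy : (i : ι) → Matrix (Fin (nx i)) (Fin ny) ℝ
  Hyy : (i : ι) → Matrix (Fin ny) (Fin ny) ℝ
  hx : (i : ι) → Fin (nx i) → ℝ
  hy : (i : ι) → Fin ny → ℝ
  Ax : (i : ι) → Matrix (Fin (na i)) (Fin (nx i)) ℝ
  Ay : (i : ι) → Matrix (Fin (na i)) (Fin ny) ℝ
  b : (i : ι) → Fin (na i) → ℝ
  Bx : (i : ι) → Matrix (Fin (nb i)) (Fin (nx i)) ℝ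
  By : (i : ι) → Matrix (Fin (nb i)) (Fin ny) ℝ
  d : (i : ι) → Fin (nb i) → ℝ
  /-- number of coupling equality constraints -/
  mg : ℕ
  /-- number of coupling inequality constraints -/
  kg : ℕ
  Ag : Matrix (Fin mg) (Fin ny) ℝ
  bg : Fin mg → ℝ
  Bg : Matrix (Fin kg) (Fin ny) ℝ
  dg : Fin kg → ℝ

/-- The two smooth relaxations of the consensus constraint `z i = y`, with their fixed parameters:
the augmented Lagrangian with barrier parameter `δ`, penalty `ρ` and multipliers `lam i`, and the
elastic `ℓ1` penalty with barrier parameter `δ` and weight `lbar`. -/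
inductive Relaxation (ι : Type*) (ny : ℕ) where
  | augLag (δ ρ : ℝ) (lam : ι → Fin ny → ℝ)
  | ellOne (δ lbar : ℝ)

/-- Admissible fixed parameters: all barrier and penalty parameters are positive. -/
def Relaxation.Admissible {ι : Type*} {ny : ℕ} : Relaxation ι ny → Prop
  | .augLag δ ρ _ => 0 < δ ∧ 0 < ρ
  | .ellOne δ lbar => 0 < δ ∧ 0 < lbar

namespace NetworkQP

variable {ι : Type*} {ny : ℕ} (P : NetworkQP ι ny)

/-- The quadratic form `[x; y]ᵀ [Hxx, Hxy; Hxyᵀ, Hyy] [x; y]` of subsystem `i`. -/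
def quadForm (i : ι) (x : Fin (P.nx i) → ℝ) (y : Fin ny → ℝ) : ℝ :=
  Sum.elim x y ⬝ᵥ (fromBlocks (P.Hxx i) (P.Hxy i) (P.Hxy i)ᵀ (P.Hyy i) *ᵥ Sum.elim x y)

/-- The cost of subsystem `i`. -/
noncomputable def localCost (i : ι) (x : Fin (P.nx i) → ℝ) (y : Fin ny → ℝ) : ℝ :=
  1 / 2 * P.quadForm i x y + (P.hx i ⬝ᵥ x + P.hy i ⬝ᵥ y)

/-- The quadratic program has a strongly convex objective in all its variables `(x, y)`. -/
def IsStronglyConvex [Fintype ι] : Prop :=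
  ∃ m : ℝ, 0 < m ∧ StrongConvexOn Set.univ m
    (fun p : ((i : ι) → Fin (P.nx i) → ℝ) × (Fin ny → ℝ) => ∑ i, P.localCost i (p.1 i) p.2)

/-- Regularity of the subsystems: the Hessian of each local cost is positive definite on the null
space of the local equality constraints, and the matrix of all local constraints has full row
rank. -/
structure Regular : Prop where
  reducedHessian_pos : ∀ (i : ι) (x : Fin (P.nx i) → ℝ) (y : Fin ny → ℝ),
    (x ≠ 0 ∨ y ≠ 0) → P.Ax i *ᵥ x + P.Ay i *ᵥ y = 0 → 0 < P.quadForm i x y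
  full_row_rank : ∀ i : ι,
    (fromBlocks (P.Ax i) (P.Ay i) (P.Bx i) (P.By i)).rank = P.na i + P.nb i

/-- `(x, z, s)` satisfies the constraints of the barrier subproblem of subsystem `i`, including
that the slack `s` lies in the domain of the logarithmic barrier. -/
def LocalFeasible (i : ι) (x : Fin (P.nx i) → ℝ) (z : Fin ny → ℝ) (s : Fin (P.nb i) → ℝ) : Prop :=
  P.Ax i *ᵥ x + P.Ay i *ᵥ z - P.b i = 0 ∧
  P.Bx i *ᵥ x + P.By i *ᵥ z + s - P.d i = 0 ∧
  ∀ j, 0 < s j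

/-- The set of attainable objective values of the relaxed barrier subproblem of subsystem `i` at
the coupling vector `y`. In the augmented Lagrangian variant the cost is evaluated at `y` and the
constraints at `z`; in the `ℓ1` variant both are evaluated at `z`. -/
def subproblemValues : Relaxation ι ny → ι → (Fin ny → ℝ) → Set ℝ
  | .augLag δ ρ lam, i, y =>
    {c | ∃ (x : Fin (P.nx i) → ℝ) (s : Fin (P.nb i) → ℝ) (z : Fin ny → ℝ),
      P.LocalFeasible i x z s ∧
      c = P.localCost i x y + lam i ⬝ᵥ (y - z) + ρ / 2 * ((y - z) ⬝ᵥ (y - z))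
        - δ * ∑ j, Real.log (s j)}
  | .ellOne δ lbar, i, y =>
    {c | ∃ (x : Fin (P.nx i) → ℝ) (s : Fin (P.nb i) → ℝ) (z v w : Fin ny → ℝ),
      P.LocalFeasible i x z s ∧ (∀ j, 0 < v j) ∧ (∀ j, 0 < w j) ∧ y - z - v + w = 0 ∧
      c = P.localCost i x z + lbar * ∑ j, (v j + w j)
        - δ * (∑ j, Real.log (s j) + ∑ j, Real.log (v j) + ∑ j, Real.log (w j))}

/-- The smoothed value function `φ i` of subsystem `i`. -/
noncomputable def phi (R : Relaxation ι ny) (i : ι) (y : Fin ny → ℝ) : ℝ :=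
  sInf (P.subproblemValues R i y)

/-- The objective of the master problem, which is also the merit function of the line search. -/
noncomputable def psi [Fintype ι] (R : Relaxation ι ny) (y : Fin ny → ℝ) : ℝ :=
  ∑ i, P.phi R i y

/-- The feasible set of the master problem. -/
def masterFeasible : Set (Fin ny → ℝ) :=
  {y | P.Ag *ᵥ y - P.bg = 0 ∧ P.Bg *ᵥ y - P.dg ≤ 0}

/-- The objective of the coordination problem at `y`: the sum over the subsystems of
`1/2 Δᵀ ∇²φ_i(y) Δ + ∇φ_i(y)ᵀ Δ`. -/
noncomputable def coordObjective [Fintype ι] (R : Relaxation ι ny) (y Δ : Fin ny → ℝ) : ℝ :=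
  ∑ i, (1 / 2 * fderiv ℝ (fderiv ℝ (P.phi R i)) y Δ Δ + fderiv ℝ (P.phi R i) y Δ)

/-- `Δ` solves the coordination problem at `y`. -/
def IsSearchDirection [Fintype ι] (R : Relaxation ι ny) (y Δ : Fin ny → ℝ) : Prop :=
  y + Δ ∈ P.masterFeasible ∧
  ∀ Δ' : Fin ny → ℝ, y + Δ' ∈ P.masterFeasible →
    P.coordObjective R y Δ ≤ P.coordObjective R y Δ'

/-- The Armijo condition `ψ(y) - ψ(y + α Δ) ≥ - σ α ∇ψ(y)ᵀ Δ`. -/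
def Armijo [Fintype ι] (R : Relaxation ι ny) (σ : ℝ) (y Δ : Fin ny → ℝ) (α : ℝ) : Prop :=
  P.psi R y - P.psi R (y + α • Δ) ≥ -σ * α * fderiv ℝ (P.psi R) y Δ

/-- `α` is the step size found by backtracking: start with `α = 1` and replace `α` by `ζ * α` as
long as the Armijo condition fails. -/
def IsBacktrackingStep [Fintype ι] (R : Relaxation ι ny) (σ ζ : ℝ) (y Δ : Fin ny → ℝ) (α : ℝ) :
    Prop :=
  ∃ m : ℕ, α = ζ ^ m ∧ P.Armijo R σ y Δ (ζ ^ m) ∧ ∀ l < m, ¬ P.Armijo R σ y Δ (ζ ^ l)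

/-- `y`, `Δ`, `α` are the iterates, search directions and step sizes of the master problem solver
started at `y0`. The solver stops at the first `k` with `Δ k = 0` and returns `y k`; as a step with
`Δ k = 0` leaves `y k` unchanged, a terminating run is continued by a constant sequence. -/
structure IsRun [Fintype ι] (R : Relaxation ι ny) (σ ζ : ℝ) (y0 : Fin ny → ℝ)
    (y Δ : ℕ → Fin ny → ℝ) (α : ℕ → ℝ) : Prop where
  init : y 0 = y0
  direction : ∀ k, P.IsSearchDirection R (y k) (Δ k)
  step : ∀ k, P.IsBacktrackingStep R σ ζ (y k) (Δ k) (α k)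
  update : ∀ k, y (k + 1) = y k + α k • Δ k

end NetworkQP

/-! Each subproblem becomes a barrier problem without equality constraints: the slacks `s`, and for
the ℓ1 relaxation also `w = z + v - y`, are eliminated, and `(x, z)` is a particular solution plus
an element of `nullSpace`. What remains is a quadratic minus `δ` times logarithms of affine
functions on an open convex set. Full row rank makes every slice at fixed `y` nonempty, and the
growth of the quadratic part beats the logarithms, so a minimizer exists
(`LogBarrier.exists_minimizer`).

The Hessian in the inner variables is positive definite, so the implicit function theorem makes the
minimizer C¹ in `y`. The inner gradient vanishes there, so the value function is C², and its second
derivative along `h` is that of the objective along `(h, w)` for some `w`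
(`contDiff_two_partial_min`). Hence `ψ` has a positive definite Hessian: for the augmented
Lagrangian by strong convexity of the summed cost, for ℓ1 by the reduced Hessians and the logarithms
of `v` and `w`. It also grows at least linearly.

The rest is damped Newton on a closed convex set (`tendsto_newton_armijo`). The iterates stay in a
compact sublevel set, on which step sizes are bounded below; sufficient decrease then drives the
slopes along the search directions to zero. Comparing a search direction with `t • (x - y k)`, where
`x` is the minimizer, gives in the limit `t * (l - ψ x) ≤ t ^ 2 / 2 * M` for all `t` in `[0, 1]`. So
the limit `l` of the values is the minimum, and strictness makes `x` the only cluster point. -/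

/-! ### Smoothness of parametric minima -/

section ValueFunction

variable {E Y : Type*} [NormedAddCommGroup E] [NormedSpace ℝ E]
  [NormedAddCommGroup Y] [NormedSpace ℝ Y]
  {Ω : Set (Y × E)} {F : Y × E → ℝ} {G : Y × E → (Y × E →L[ℝ] ℝ)}

/-- On a convex slice, a function with positive definite partial Hessian has at most one critical
point. -/
theorem eq_of_partial_critical (hG : ∀ p ∈ Ω, ContDiffAt ℝ 1 G p)
    (hconv : ∀ y, Convex ℝ {u | (y, u) ∈ Ω})
    (hpos : ∀ p ∈ Ω, ∀ e : E, e ≠ 0 → 0 < fderiv ℝ G p (0, e) (0, e))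
    {y : Y} {u u' : E} (hu : (y, u) ∈ Ω) (hu' : (y, u') ∈ Ω)
    (hc : ∀ e, G (y, u) (0, e) = 0) (hc' : ∀ e, G (y, u') (0, e) = 0) : u = u' := by
  by_contra hne
  have he : u' - u ≠ 0 := sub_ne_zero.2 (Ne.symm hne)
  set e := u' - u with he_def
  have hmem : ∀ t ∈ Set.Icc (0 : ℝ) 1, (y, u + t • e) ∈ Ω := fun t ht => by
    have := (hconv y).add_smul_sub_mem (x := u) (y := u') hu hu' ht
    simpa [he_def] using this
  have hderiv : ∀ t ∈ Set.Icc (0 : ℝ) 1, HasDerivAt (fun t : ℝ => G (y, u + t • e) (0, e))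
      (fderiv ℝ G (y, u + t • e) (0, e) (0, e)) t := fun t ht => by
    have h1 : HasFDerivAt G (fderiv ℝ G (y, u + t • e)) (y, u + t • e) :=
      ((hG _ (hmem t ht)).differentiableAt one_ne_zero).hasFDerivAt
    have h2 : HasDerivAt (fun t : ℝ => (y, u + t • e)) ((0 : Y), e) t := by
      have h3 : HasDerivAt (fun t : ℝ => u + t • e) e t := by
        simpa using ((hasDerivAt_id t).smul_const e).const_add u
      exact (hasDerivAt_const t y).prodMk h3
    have h4 := h1.comp_hasDerivAt t h2
    simpa using h4.clm_apply (hasDerivAt_const t ((0 : Y), e))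
  -- Rolle: the inner derivative along `e` vanishes at both ends of the segment, yet has positive
  -- derivative.
  obtain ⟨t, ht, h0⟩ := exists_hasDerivAt_eq_zero (f := fun t : ℝ => G (y, u + t • e) (0, e))
    (f' := fun t : ℝ => fderiv ℝ G (y, u + t • e) (0, e) (0, e)) zero_lt_one
    (fun t ht => (hderiv t ht).continuousAt.continuousWithinAt)
    (by simp [hc, hc', he_def]) (fun t ht => hderiv t (Set.Ioo_subset_Icc_self ht))
  exact (hpos _ (hmem t (Set.Ioo_subset_Icc_self ht)) e he).ne' h0

theorem partial_critical_of_minimizer (hΩ : IsOpen Ω) (hF : ∀ p ∈ Ω, HasFDerivAt F (G p) p)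
    {y : Y} {u : E} (hu : (y, u) ∈ Ω) (hmin : ∀ u', (y, u') ∈ Ω → F (y, u) ≤ F (y, u')) (e : E) :
    G (y, u) (0, e) = 0 := by
  have h1 : HasFDerivAt (fun u => F (y, u)) ((G (y, u)).comp (.inr ℝ Y E)) u :=
    (hF _ hu).comp u (hasFDerivAt_prodMk_right y u)
  have h2 : IsLocalMin (fun u => F (y, u)) u := by
    have : ∀ᶠ u' in 𝓝 u, (y, u') ∈ Ω :=
      (Continuous.prodMk_right y).continuousAt.eventually_mem (hΩ.mem_nhds hu)
    filter_upwards [this] with u' h using hmin u' h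
  simpa using DFunLike.congr_fun (h2.hasFDerivAt_eq_zero h1) e

variable [FiniteDimensional ℝ E]

theorem isInvertible_of_pos {B : E →L[ℝ] (E →L[ℝ] ℝ)} (hB : ∀ e, e ≠ 0 → 0 < B e e) :
    B.IsInvertible := by
  have hinj : Function.Injective B := by
    refine (injective_iff_map_eq_zero B).2 fun e he => ?_
    by_contra hne
    simpa [he] using hB e hne
  have hfin : Module.finrank ℝ E = Module.finrank ℝ (E →L[ℝ] ℝ) := by
    rw [← LinearMap.toContinuousLinearMap.finrank_eq]
    exact (Subspace.dual_finrank_eq (K := ℝ) (V := E)).symm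
  exact ⟨(LinearEquiv.ofInjectiveOfFinrankEq (B : E →ₗ[ℝ] (E →L[ℝ] ℝ)) hinj
    hfin).toContinuousLinearEquiv, by ext; rfl⟩

variable [CompleteSpace Y]

/-- No continuity of `us` is assumed. The implicit function solving the stationarity equation is C¹,
and uniqueness of critical points in a slice identifies it with `us` near `y`. -/
theorem contDiff_one_of_partial_minimizers (hΩ : IsOpen Ω) (hF : ∀ p ∈ Ω, HasFDerivAt F (G p) p)
    (hG : ∀ p ∈ Ω, ContDiffAt ℝ 1 G p) (hconv : ∀ y, Convex ℝ {u | (y, u) ∈ Ω})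
    (hpos : ∀ p ∈ Ω, ∀ e : E, e ≠ 0 → 0 < fderiv ℝ G p (0, e) (0, e))
    {us : Y → E} (hmem : ∀ y, (y, us y) ∈ Ω)
    (hmin : ∀ y u, (y, u) ∈ Ω → F (y, us y) ≤ F (y, u)) : ContDiff ℝ 1 us := by
  have hcrit := fun y => partial_critical_of_minimizer hΩ hF (hmem y) (hmin y)
  rw [contDiff_iff_contDiffAt]
  intro y
  let R : (Y × E →L[ℝ] ℝ) →L[ℝ] (E →L[ℝ] ℝ) :=
    ContinuousLinearMap.precomp ℝ (ContinuousLinearMap.inr ℝ Y E)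
  have hC : ContDiffAt ℝ 1 (fun p => R (G p)) (y, us y) :=
    R.contDiff.contDiffAt.comp _ (hG _ (hmem y))
  have hD : fderiv ℝ (fun p => R (G p)) (y, us y) = R.comp (fderiv ℝ G (y, us y)) :=
    (R.hasFDerivAt.comp _ ((hG _ (hmem y)).differentiableAt one_ne_zero).hasFDerivAt).fderiv
  have hinv : (fderiv ℝ (fun p => R (G p)) (y, us y) ∘L .inr ℝ Y E).IsInvertible := by
    refine isInvertible_of_pos fun e he => ?_
    rw [hD]
    simpa [R] using hpos _ (hmem y) e he
  have hg := hC.contDiffAt_implicitFunction one_ne_zero hinv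
  refine hg.congr_of_eventuallyEq ?_
  have h1 := hC.eventually_apply_implicitFunction one_ne_zero hinv
  have h2 : ∀ᶠ x in 𝓝 y, (x, hC.implicitFunction one_ne_zero hinv x) ∈ Ω := by
    refine ContinuousAt.eventually_mem (f := fun x => (x, hC.implicitFunction one_ne_zero hinv x))
      (continuousAt_id.prodMk hg.continuousAt) (hΩ.mem_nhds ?_)
    have := hC.implicitFunction_apply_self one_ne_zero hinv
    simpa [this] using hmem y
  filter_upwards [h1, h2] with x hx1 hx2
  refine eq_of_partial_critical hG hconv hpos (hmem x) hx2 (hcrit x) fun e => ?_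
  have h3 := DFunLike.congr_fun hx1 e
  simpa [R, hcrit y e] using h3

/-- The value function of a parametric minimization problem with positive definite partial Hessian
is twice continuously differentiable, and its Hessian is obtained from the Hessian of the objective
by extending the parameter direction suitably. -/
theorem contDiff_two_partial_min (hΩ : IsOpen Ω) (hF : ∀ p ∈ Ω, HasFDerivAt F (G p) p)
    (hG : ∀ p ∈ Ω, ContDiffAt ℝ 1 G p) (hconv : ∀ y, Convex ℝ {u | (y, u) ∈ Ω})
    (hpos : ∀ p ∈ Ω, ∀ e : E, e ≠ 0 → 0 < fderiv ℝ G p (0, e) (0, e))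
    {us : Y → E} (hmem : ∀ y, (y, us y) ∈ Ω)
    (hmin : ∀ y u, (y, u) ∈ Ω → F (y, us y) ≤ F (y, u)) :
    ContDiff ℝ 2 (fun y => F (y, us y)) ∧
    ∀ y h, ∃ w, fderiv ℝ (fderiv ℝ (fun y => F (y, us y))) y h h
      = fderiv ℝ G (y, us y) (h, w) (h, w) := by
  have hus := contDiff_one_of_partial_minimizers hΩ hF hG hconv hpos hmem hmin
  have hcrit := fun y => partial_critical_of_minimizer hΩ hF (hmem y) (hmin y)
  let R : (Y × E →L[ℝ] ℝ) →L[ℝ] (Y →L[ℝ] ℝ) :=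
    ContinuousLinearMap.precomp ℝ (ContinuousLinearMap.inl ℝ Y E)
  have hus' : ∀ y, HasFDerivAt us (fderiv ℝ us y) y := fun y =>
    (hus.contDiffAt.differentiableAt one_ne_zero).hasFDerivAt
  have hpair : ∀ y, HasFDerivAt (fun y => (y, us y))
      ((ContinuousLinearMap.id ℝ Y).prod (fderiv ℝ us y)) y := fun y =>
    (hasFDerivAt_id y).prodMk (hus' y)
  -- Envelope argument: the contribution of the moving minimizer is a partial gradient in `u`, which
  -- vanishes.
  have hφ : ∀ y, HasFDerivAt (fun y => F (y, us y)) (R (G (y, us y))) y := fun y => by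
    have h1 := (hF _ (hmem y)).comp y (hpair y)
    convert! h1 using 1
    ext k
    have h2 : ((k, fderiv ℝ us y k) : Y × E) = (k, 0) + (0, fderiv ℝ us y k) := by simp
    simp only [ContinuousLinearMap.comp_apply, ContinuousLinearMap.prod_apply,
      ContinuousLinearMap.id_apply]
    rw [h2, map_add, hcrit]
    simp [R]
  have hφ' : fderiv ℝ (fun y => F (y, us y)) = fun y => R (G (y, us y)) :=
    funext fun y => (hφ y).fderiv
  have hGus : ContDiff ℝ 1 (fun y => G (y, us y)) := contDiff_iff_contDiffAt.2 fun y =>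
    (hG _ (hmem y)).comp y (contDiffAt_id.prodMk hus.contDiffAt)
  refine ⟨?_, fun y h => ⟨fderiv ℝ us y h, ?_⟩⟩
  · rw [show (2 : WithTop ℕ∞) = 1 + 1 by norm_num, contDiff_succ_iff_fderiv]
    refine ⟨fun y => (hφ y).differentiableAt, by simp, ?_⟩
    rw [hφ']
    exact R.contDiff.comp hGus
  · set w := fderiv ℝ us y h
    have h1 : HasFDerivAt (fun y => G (y, us y)) ((fderiv ℝ G (y, us y)).comp
        ((ContinuousLinearMap.id ℝ Y).prod (fderiv ℝ us y))) y :=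
      ((hG _ (hmem y)).differentiableAt one_ne_zero).hasFDerivAt.comp y (hpair y)
    have h2 : fderiv ℝ (fun y => R (G (y, us y))) y h h
        = fderiv ℝ G (y, us y) (h, w) (h, 0) := by
      have h3 : HasFDerivAt (fun y => R (G (y, us y))) _ y := R.hasFDerivAt.comp y h1
      rw [h3.fderiv]
      simp [R, w]
    -- Stationarity holds identically in `y`; it is differentiated along `h` with `w` frozen. This
    -- lets `(h, 0)` be replaced by `(h, w)` in the second slot.
    have h3 : fderiv ℝ G (y, us y) (h, w) (0, w) = 0 := by
      have h4 : HasFDerivAt (fun y => G (y, us y) (0, w)) _ y :=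
        h1.clm_apply (hasFDerivAt_const ((0 : Y), w) y)
      have h5 : (fun y => G (y, us y) (0, w)) = fun _ => 0 := funext fun y => hcrit y w
      rw [h5] at h4
      have h6 := DFunLike.congr_fun (h4.unique (hasFDerivAt_const (0 : ℝ) y)) h
      simpa [w] using h6
    have h7 : ((h, w) : Y × E) = (h, 0) + (0, w) := by simp
    rw [hφ', h2]
    conv_rhs => rw [h7, map_add, ← h7, h3, add_zero]

end ValueFunction

/-! ### Constrained Newton method with Armijo backtracking -/

section NewtonMethod

open scoped Pointwise

variable {Y : Type*} [NormedAddCommGroup Y] [NormedSpace ℝ Y]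

/-- The second order model of `ψ` at `y`, without its constant term. -/
noncomputable def newtonModel (ψ : Y → ℝ) (y Δ : Y) : ℝ :=
  1 / 2 * fderiv ℝ (fderiv ℝ ψ) y Δ Δ + fderiv ℝ ψ y Δ

/-- `Δ` minimizes the second order model of `ψ` at `y` over the shifted feasible set. -/
def IsNewtonDirection (ψ : Y → ℝ) (S : Set Y) (y Δ : Y) : Prop :=
  y + Δ ∈ S ∧ ∀ Δ', y + Δ' ∈ S → newtonModel ψ y Δ ≤ newtonModel ψ y Δ'

/-- The sufficient decrease condition of Armijo. -/
def SufficientDecrease (ψ : Y → ℝ) (σ : ℝ) (y Δ : Y) (α : ℝ) : Prop :=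
  ψ y - ψ (y + α • Δ) ≥ -σ * α * fderiv ℝ ψ y Δ

theorem exists_second_order_taylor {ψ : Y → ℝ} (hψ : ContDiff ℝ 2 ψ) (y e : Y) :
    ∃ t ∈ Set.Ioo (0 : ℝ) 1, ψ (y + e) = ψ y + fderiv ℝ ψ y e
      + 1 / 2 * fderiv ℝ (fderiv ℝ ψ) (y + t • e) e e := by
  have hline : ∀ t : ℝ, HasDerivAt (fun t : ℝ => y + t • e) e t := fun t => by
    simpa using ((hasDerivAt_id t).smul_const e).const_add y
  have h1 : ∀ t : ℝ, HasDerivAt (fun t : ℝ => ψ (y + t • e)) (fderiv ℝ ψ (y + t • e) e) t :=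
    fun t => ((hψ.differentiable (by norm_num)) _).hasFDerivAt.comp_hasDerivAt t (hline t)
  have hD : ContDiff ℝ 1 (fderiv ℝ ψ) := hψ.fderiv_right (by norm_num)
  have h2 : ∀ t : ℝ, HasDerivAt (fun t : ℝ => fderiv ℝ ψ (y + t • e) e)
      (fderiv ℝ (fderiv ℝ ψ) (y + t • e) e e) t := fun t => by
    have h := ((hD.differentiable one_ne_zero) _).hasFDerivAt.comp_hasDerivAt t (hline t)
    simpa using h.clm_apply (hasDerivAt_const t e)
  -- This `K` gives the function in `h3` equal values at 0 and 1. Its derivative then vanishes at 0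
  -- and at some `s`, so Rolle applies a second time.
  set K := ψ (y + e) - ψ y - fderiv ℝ ψ y e with hK
  have h3 : ∀ t : ℝ, HasDerivAt (fun t : ℝ => ψ (y + t • e) - t * fderiv ℝ ψ y e - t ^ 2 * K)
      (fderiv ℝ ψ (y + t • e) e - fderiv ℝ ψ y e - 2 * t * K) t := fun t => by
    exact (((h1 t).sub ((hasDerivAt_id t).mul_const (fderiv ℝ ψ y e))).sub
      ((hasDerivAt_pow 2 t).mul_const K)).congr_deriv (by simp)
  have h4 : ∀ t : ℝ, HasDerivAt (fun t : ℝ => fderiv ℝ ψ (y + t • e) e - fderiv ℝ ψ y e - 2 * t * K)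
      (fderiv ℝ (fderiv ℝ ψ) (y + t • e) e e - 2 * K) t := fun t => by
    exact (((h2 t).sub_const (fderiv ℝ ψ y e)).sub
      (((hasDerivAt_id t).const_mul 2).mul_const K)).congr_deriv (by simp)
  obtain ⟨s, hs, hs0⟩ := exists_hasDerivAt_eq_zero zero_lt_one
    (fun t _ => (h3 t).continuousAt.continuousWithinAt) (by simp [hK]) (fun t _ => h3 t)
  obtain ⟨t, ht, ht0⟩ := exists_hasDerivAt_eq_zero hs.1
    (fun t _ => (h4 t).continuousAt.continuousWithinAt) (by simp only [hs0]; simp) (fun t _ => h4 t)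
  refine ⟨t, ⟨ht.1, ht.2.trans hs.2⟩, ?_⟩
  linarith

section PositiveHessian

variable {ψ : Y → ℝ} {S : Set Y}

theorem fderiv_lt_of_pos (hψ : ContDiff ℝ 2 ψ)
    (hpos : ∀ y h, h ≠ 0 → 0 < fderiv ℝ (fderiv ℝ ψ) y h h) (y : Y) {e : Y} (he : e ≠ 0) :
    fderiv ℝ ψ y e < ψ (y + e) - ψ y := by
  obtain ⟨t, -, ht⟩ := exists_second_order_taylor hψ y e
  linarith [hpos (y + t • e) e he]

theorem fderiv_le_of_pos (hψ : ContDiff ℝ 2 ψ)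
    (hpos : ∀ y h, h ≠ 0 → 0 < fderiv ℝ (fderiv ℝ ψ) y h h) (y e : Y) :
    fderiv ℝ ψ y e ≤ ψ (y + e) - ψ y := by
  rcases eq_or_ne e 0 with rfl | he
  · simp
  · exact (fderiv_lt_of_pos hψ hpos y he).le

/-- If `ψ y ≤ ψ x`, the strict tangent inequalities at the midpoint in the directions `e` and `-e`
add up to a midpoint value below `ψ x`. -/
theorem lt_of_minimizer_of_pos (hψ : ContDiff ℝ 2 ψ)
    (hpos : ∀ y h, h ≠ 0 → 0 < fderiv ℝ (fderiv ℝ ψ) y h h) (hS : Convex ℝ S) {x y : Y}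
    (hx : x ∈ S) (hmin : ∀ z ∈ S, ψ x ≤ ψ z) (hy : y ∈ S) (hne : y ≠ x) : ψ x < ψ y := by
  by_contra! hle
  set e := (1 / 2 : ℝ) • (y - x) with he_def
  have he : e ≠ 0 := smul_ne_zero (by norm_num) (sub_ne_zero.2 hne)
  have hm : x + e ∈ S := hS.add_smul_sub_mem hx hy ⟨by norm_num, by norm_num⟩
  have hye : x + e + e = y := by
    rw [add_assoc, ← two_smul ℝ e, he_def, smul_smul]; simp
  have h1 := fderiv_lt_of_pos hψ hpos (x + e) he
  have h2 := fderiv_lt_of_pos hψ hpos (x + e) (neg_ne_zero.2 he)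
  rw [hye] at h1
  simp only [map_neg, add_neg_cancel_right] at h2
  linarith [hmin _ hm]

/-- First-order optimality of `Δ` on the segment from 0: compare with `t • Δ`, divide by `1 - t`,
and let `t` approach 1. -/
theorem IsNewtonDirection.curvature_add_slope_nonpos (hS : Convex ℝ S) {y Δ : Y} (hy : y ∈ S)
    (hΔ : IsNewtonDirection ψ S y Δ) :
    fderiv ℝ (fderiv ℝ ψ) y Δ Δ + fderiv ℝ ψ y Δ ≤ 0 := by
  set a := fderiv ℝ (fderiv ℝ ψ) y Δ Δ
  set b := fderiv ℝ ψ y Δ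
  have h : ∀ t ∈ Set.Ico (0 : ℝ) 1, (t + 1) / 2 * a + b ≤ 0 := fun t ht => by
    have hmem : y + t • Δ ∈ S := by
      simpa using hS.add_smul_sub_mem hy hΔ.1 ⟨ht.1, ht.2.le⟩
    have h1 := hΔ.2 _ hmem
    simp only [newtonModel, map_smul, _root_.smul_apply, smul_eq_mul] at h1
    change 1 / 2 * a + b ≤ 1 / 2 * (t * (t * a)) + t * b at h1
    have h2 : (1 - t) * ((t + 1) / 2 * a + b) ≤ 0 := by linarith
    exact nonpos_of_mul_nonpos_right h2 (by linarith [ht.2])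
  by_contra! hlt
  have h0 := h 0 ⟨le_rfl, zero_lt_one⟩
  have ha : 0 < a := by linarith
  -- This `t` is close enough to 1 that `(t + 1) / 2 * a + b ≥ (a + b) / 2 > 0`.
  have h1 := h (1 - min 1 ((a + b) / a)) ⟨by linarith [min_le_left 1 ((a + b) / a)],
    by linarith [lt_min one_pos (div_pos hlt ha)]⟩
  have h2 : min 1 ((a + b) / a) * a ≤ a + b := by
    rw [← le_div_iff₀ ha]; exact min_le_right _ _
  linarith

/-- Compares `Δ` with `t • (x - y)` and bounds the slope there by convexity. This converts a model
value near zero into a small optimality gap. -/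
theorem IsNewtonDirection.model_le (hψ : ContDiff ℝ 2 ψ)
    (hpos : ∀ y h, h ≠ 0 → 0 < fderiv ℝ (fderiv ℝ ψ) y h h) (hS : Convex ℝ S) {x y Δ : Y}
    (hx : x ∈ S) (hy : y ∈ S) (hΔ : IsNewtonDirection ψ S y Δ) {t : ℝ}
    (ht : t ∈ Set.Icc (0 : ℝ) 1) :
    newtonModel ψ y Δ
      ≤ t ^ 2 / 2 * fderiv ℝ (fderiv ℝ ψ) y (x - y) (x - y) + t * (ψ x - ψ y) := by
  have h1 := hΔ.2 (t • (x - y)) (hS.add_smul_sub_mem hy hx ht)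
  refine h1.trans ?_
  have h2 := mul_le_mul_of_nonneg_left (fderiv_le_of_pos hψ hpos y (x - y)) ht.1
  simp only [newtonModel, map_smul, _root_.smul_apply, smul_eq_mul]
  rw [add_sub_cancel] at h2
  linarith

theorem IsNewtonDirection.eq_minimizer (hψ : ContDiff ℝ 2 ψ)
    (hpos : ∀ y h, h ≠ 0 → 0 < fderiv ℝ (fderiv ℝ ψ) y h h) (hS : Convex ℝ S) {x y : Y}
    (hx : x ∈ S) (hmin : ∀ z ∈ S, z ≠ x → ψ x < ψ z) (hy : y ∈ S)
    (hΔ : IsNewtonDirection ψ S y 0) : y = x := by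
  by_contra hne
  have hlt := hmin y hy hne
  have hc := hpos y (x - y) (sub_ne_zero.2 (Ne.symm hne))
  set c := fderiv ℝ (fderiv ℝ ψ) y (x - y) (x - y)
  have hm : newtonModel ψ y 0 = 0 := by simp [newtonModel]
  -- With this `t` the quadratic term is at most half the linear gain, so the bound on the model is
  -- negative, although the model vanishes at 0.
  have ht : 0 < min 1 ((ψ y - ψ x) / c) := lt_min one_pos (div_pos (by linarith) hc)
  have h1 := hΔ.model_le hψ hpos hS hx hy ⟨ht.le, min_le_left _ _⟩
  have h2 : min 1 ((ψ y - ψ x) / c) * c ≤ ψ y - ψ x := by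
    rw [← le_div_iff₀ hc]; exact min_le_right _ _
  set t := min 1 ((ψ y - ψ x) / c)
  rw [hm] at h1
  have h3 := mul_le_mul_of_nonneg_left h2 ht.le
  have h4 := mul_pos ht (sub_pos.2 hlt)
  change 0 ≤ t ^ 2 / 2 * c + t * (ψ x - ψ y) at h1
  nlinarith

variable [FiniteDimensional ℝ Y]

/-- A continuous family of positive definite forms is uniformly positive definite on compacts. -/
theorem IsCompact.exists_uniform_pos {X : Type*} [TopologicalSpace X] {K : Set X}
    (hK : IsCompact K) {B : X → (Y →L[ℝ] Y →L[ℝ] ℝ)} (hB : ContinuousOn B K)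
    (hpos : ∀ x ∈ K, ∀ h, h ≠ 0 → 0 < B x h h) :
    ∃ c > 0, ∀ x ∈ K, ∀ h, c * ‖h‖ ^ 2 ≤ B x h h := by
  have := FiniteDimensional.proper ℝ Y
  -- By homogeneity of degree two it suffices to bound the form below on unit vectors.
  have hcomp : IsCompact (K ×ˢ Metric.sphere (0 : Y) 1) := hK.prod (isCompact_sphere 0 1)
  have hcont : ContinuousOn (fun p : X × Y => B p.1 p.2 p.2) (K ×ˢ Metric.sphere (0 : Y) 1) := by
    have h1 : ContinuousOn (fun p : X × Y => B p.1) (K ×ˢ Metric.sphere (0 : Y) 1) :=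
      hB.comp continuousOn_fst fun p hp => hp.1
    exact (h1.clm_apply continuousOn_snd).clm_apply continuousOn_snd
  obtain ⟨c, hc, hle⟩ : ∃ c > 0, ∀ p ∈ K ×ˢ Metric.sphere (0 : Y) 1, c ≤ B p.1 p.2 p.2 := by
    rcases (K ×ˢ Metric.sphere (0 : Y) 1).eq_empty_or_nonempty with he | hne
    · exact ⟨1, one_pos, by simp [he]⟩
    · obtain ⟨p, hp, hmin⟩ := hcomp.exists_isMinOn hne hcont
      refine ⟨B p.1 p.2 p.2, hpos _ hp.1 _ ?_, fun q hq => hmin hq⟩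
      rintro h0
      have := hp.2
      simp [h0] at this
  refine ⟨c, hc, fun x hx h => ?_⟩
  rcases eq_or_ne h 0 with rfl | hh
  · simp
  have hn : 0 < ‖h‖ := norm_pos_iff.2 hh
  have h1 := hle (x, ‖h‖⁻¹ • h) ⟨hx, by simp [norm_smul, hn.ne']⟩
  simp only [map_smul, _root_.smul_apply, smul_eq_mul] at h1
  have h2 : ‖h‖⁻¹ * (‖h‖⁻¹ * B x h h) * ‖h‖ ^ 2 = B x h h := by field_simp
  rw [← h2]
  exact mul_le_mul_of_nonneg_right h1 (by positivity)

theorem exists_norm_sub_le_quadratic {B : Y →L[ℝ] Y →L[ℝ] ℝ} (hB : ∀ h, h ≠ 0 → 0 < B h h)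
    (l : Y →L[ℝ] ℝ) : ∃ C, ∀ p, ‖p‖ - C ≤ 1 / 2 * B p p + l p := by
  -- A single form is a family over a point. The constant below comes from completing the square in
  -- `(1 + ‖l‖) * r - c * r ^ 2 / 2`.
  obtain ⟨c, hc, hle⟩ := isCompact_singleton.exists_uniform_pos (K := {()}) (B := fun _ => B)
    continuousOn_const fun _ _ => hB
  refine ⟨(1 + ‖l‖) ^ 2 / (2 * c), fun p => ?_⟩
  have h1 := hle () rfl p
  have h2 : -(‖l‖ * ‖p‖) ≤ l p := (abs_le.1 (l.le_opNorm p)).1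
  have h3 : (1 + ‖l‖) * ‖p‖ - (1 + ‖l‖) ^ 2 / (2 * c) ≤ 1 / 2 * (c * ‖p‖ ^ 2) := by
    rw [sub_le_iff_le_add, ← sub_le_iff_le_add', le_div_iff₀ (by positivity)]
    nlinarith [sq_nonneg (1 + ‖l‖ - c * ‖p‖)]
  linarith

theorem isCompact_sublevel (hψ : Continuous ψ) {η C : ℝ} (hη : 0 < η)
    (hcoer : ∀ y ∈ S, η * ‖y‖ - C ≤ ψ y) (hS : IsClosed S) (a : ℝ) :
    IsCompact {y | y ∈ S ∧ ψ y ≤ a} := by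
  have := FiniteDimensional.proper ℝ Y
  refine (isCompact_closedBall (0 : Y) ((a + C) / η)).of_isClosed_subset
    (hS.inter (isClosed_le hψ continuous_const)) fun y hy => ?_
  rw [mem_closedBall_zero_iff, le_div_iff₀ hη]
  linarith [hcoer y hy.1, hy.2, mul_comm η ‖y‖]

theorem exists_minimizer_of_coercive (hψ : Continuous ψ) {η C : ℝ} (hη : 0 < η)
    (hcoer : ∀ y ∈ S, η * ‖y‖ - C ≤ ψ y) (hS : IsClosed S) (hne : S.Nonempty) :
    ∃ x ∈ S, ∀ y ∈ S, ψ x ≤ ψ y := by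
  obtain ⟨y0, hy0⟩ := hne
  obtain ⟨x, hx, hmin⟩ := (isCompact_sublevel hψ hη hcoer hS (ψ y0)).exists_isMinOn
    ⟨y0, hy0, le_rfl⟩ hψ.continuousOn
  refine ⟨x, hx.1, fun y hy => ?_⟩
  rcases le_total (ψ y) (ψ y0) with h | h
  · exact hmin ⟨hy, h⟩
  · exact hx.2.trans h

/-- The model is coercive on a closed set, hence attains its minimum; at the midpoint of two
distinct minimizers it would be strictly smaller. -/
theorem existsUnique_isNewtonDirection (hpos : ∀ y h, h ≠ 0 → 0 < fderiv ℝ (fderiv ℝ ψ) y h h)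
    (hSc : IsClosed S) (hS : Convex ℝ S) {y : Y} (hy : y ∈ S) :
    ∃! Δ, IsNewtonDirection ψ S y Δ := by
  set B := fderiv ℝ (fderiv ℝ ψ) y with hB
  obtain ⟨C, hC⟩ := exists_norm_sub_le_quadratic (hpos y) (fderiv ℝ ψ y)
  have hcont : Continuous (newtonModel ψ y) := by
    unfold newtonModel; fun_prop
  obtain ⟨Δ, hΔ, hmin⟩ := exists_minimizer_of_coercive (S := {Δ | y + Δ ∈ S}) hcont one_pos
    (C := C) (fun p _ => by simpa [newtonModel] using hC p) (hSc.preimage (continuous_const_add y))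
    ⟨0, by simpa using hy⟩
  refine ⟨Δ, ⟨hΔ, hmin⟩, fun Δ' h' => ?_⟩
  by_contra hne
  have h1 := hmin ((1 / 2 : ℝ) • Δ + (1 / 2 : ℝ) • Δ') (by
    have := hS hΔ h'.1 (by norm_num : (0 : ℝ) ≤ 1 / 2) (by norm_num : (0 : ℝ) ≤ 1 / 2) (by norm_num)
    change y + ((1 / 2 : ℝ) • Δ + (1 / 2 : ℝ) • Δ') ∈ S
    convert this using 1
    rw [smul_add, smul_add, add_add_add_comm, ← add_smul]; norm_num)
  have h2 := h'.2 Δ hΔ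
  have h3 := hpos y (Δ' - Δ) (sub_ne_zero.2 hne)
  simp only [newtonModel, ← hB, map_add, map_sub, map_smul, _root_.add_apply,
    _root_.sub_apply, _root_.smul_apply, smul_eq_mul] at h1 h2 h3
  linarith

/-- The slope is at most `-c * ‖Δ‖ ^ 2`, with `c` the least curvature on `K`, while the Taylor
remainder is at most `α ^ 2 * M' * ‖Δ‖ ^ 2 / 2`. So a fraction `1 - σ` of the linear decrease
absorbs the remainder once `α * M' ≤ 2 * (1 - σ) * c`. -/
theorem exists_uniform_sufficientDecrease (hψ : ContDiff ℝ 2 ψ)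
    (hpos : ∀ y h, h ≠ 0 → 0 < fderiv ℝ (fderiv ℝ ψ) y h h) (hS : Convex ℝ S)
    {K : Set Y} (hK : IsCompact K) (hKS : K ⊆ S) {σ : ℝ} (hσ : σ < 1) :
    ∃ a > 0, ∀ y ∈ K, ∀ Δ, IsNewtonDirection ψ S y Δ → ∀ α, 0 ≤ α → α ≤ a →
      SufficientDecrease ψ σ y Δ α := by
  have := FiniteDimensional.proper ℝ Y
  have hD : ContDiff ℝ 1 (fderiv ℝ ψ) := hψ.fderiv_right (by norm_num)
  have hH : Continuous (fderiv ℝ (fderiv ℝ ψ)) := hD.continuous_fderiv one_ne_zero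
  obtain ⟨c, hc, hcle⟩ := hK.exists_uniform_pos hH.continuousOn fun y _ => hpos y
  obtain ⟨L, hL⟩ := hK.exists_bound_of_continuousOn hD.continuous.continuousOn
  -- Search directions from `K` have norm at most `L / c`, so this compact set contains every Taylor
  -- point.
  have hK' : IsCompact (K + Metric.closedBall (0 : Y) (L / c)) := hK.add (isCompact_closedBall _ _)
  obtain ⟨M, hM⟩ := hK'.exists_bound_of_continuousOn (f := fderiv ℝ (fderiv ℝ ψ)) hH.continuousOn
  set M' := max M 1
  have hM' : 0 < M' := lt_of_lt_of_le one_pos (le_max_right _ _)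
  refine ⟨min 1 (2 * (1 - σ) * c / M'), lt_min one_pos
    (div_pos (by have := sub_pos.2 hσ; positivity) hM'), fun y hy Δ hΔ α h0 hα => ?_⟩
  have h1 := hΔ.curvature_add_slope_nonpos hS (hKS hy)
  have h2 := hcle y hy Δ
  have h3 : -(L * ‖Δ‖) ≤ fderiv ℝ ψ y Δ :=
    (abs_le.1 (((fderiv ℝ ψ y).le_opNorm Δ).trans
      (mul_le_mul_of_nonneg_right (hL y hy) (norm_nonneg _)))).1
  have hnorm : ‖Δ‖ ≤ L / c := by
    rw [le_div_iff₀ hc]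
    rcases (norm_nonneg Δ).eq_or_lt with hz | hp
    · rw [← hz, zero_mul]; exact (norm_nonneg _).trans (hL y hy)
    · refine le_of_mul_le_mul_right ?_ hp
      nlinarith
  obtain ⟨t, ht, heq⟩ := exists_second_order_taylor hψ y (α • Δ)
  have hα1 : α ≤ 1 := hα.trans (min_le_left _ _)
  have hmem : y + t • α • Δ ∈ K + Metric.closedBall (0 : Y) (L / c) := by
    refine Set.add_mem_add hy ?_
    rw [mem_closedBall_zero_iff, norm_smul, norm_smul, Real.norm_of_nonneg ht.1.le,
      Real.norm_of_nonneg h0, ← mul_assoc]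
    exact (mul_le_of_le_one_left (norm_nonneg _) (mul_le_one₀ ht.2.le h0 hα1)).trans hnorm
  have h4 : fderiv ℝ (fderiv ℝ ψ) (y + t • α • Δ) Δ Δ ≤ M' * ‖Δ‖ ^ 2 := by
    refine (le_abs_self _).trans (((fderiv ℝ (fderiv ℝ ψ) (y + t • α • Δ)).le_opNorm₂ Δ Δ).trans ?_)
    rw [mul_assoc, ← sq]
    exact mul_le_mul_of_nonneg_right ((hM _ hmem).trans (le_max_left _ _)) (by positivity)
  have h5 : α * M' ≤ 2 * (1 - σ) * c := by
    rw [← le_div_iff₀ hM']; exact hα.trans (min_le_right _ _)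
  simp only [map_smul, _root_.smul_apply, smul_eq_mul] at heq
  unfold SufficientDecrease
  rw [heq]
  have h6 : α * M' * ‖Δ‖ ^ 2 ≤ 2 * (1 - σ) * (c * ‖Δ‖ ^ 2) := by
    rw [← mul_assoc]; exact mul_le_mul_of_nonneg_right h5 (by positivity)
  have h7 : (1 - σ) * (c * ‖Δ‖ ^ 2) ≤ (1 - σ) * -fderiv ℝ ψ y Δ :=
    mul_le_mul_of_nonneg_left (by linarith) (sub_pos.2 hσ).le
  have h8 := mul_le_mul_of_nonneg_left h4 h0
  have h9 : α * (α * fderiv ℝ (fderiv ℝ ψ) (y + t • α • Δ) Δ Δ)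
      ≤ α * (2 * (1 - σ) * -fderiv ℝ ψ y Δ) := mul_le_mul_of_nonneg_left (by linarith) h0
  linarith

end PositiveHessian

/-- `α` is the first element of `1, ζ, ζ ^ 2, …` with sufficient decrease. -/
def IsArmijoStep (ψ : Y → ℝ) (σ ζ : ℝ) (y Δ : Y) (α : ℝ) : Prop :=
  ∃ m : ℕ, α = ζ ^ m ∧ SufficientDecrease ψ σ y Δ (ζ ^ m) ∧
    ∀ l < m, ¬ SufficientDecrease ψ σ y Δ (ζ ^ l)

theorem exists_isArmijoStep {ψ : Y → ℝ} {σ ζ a : ℝ} {y Δ : Y} (ha : 0 < a) (hζ0 : 0 < ζ)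
    (hζ1 : ζ < 1) (h : ∀ α, 0 ≤ α → α ≤ a → SufficientDecrease ψ σ y Δ α) :
    ∃ α, IsArmijoStep ψ σ ζ y Δ α := by
  classical
  have hex : ∃ m : ℕ, SufficientDecrease ψ σ y Δ (ζ ^ m) := by
    obtain ⟨m, hm⟩ := exists_pow_lt_of_lt_one ha hζ1
    exact ⟨m, h _ (by positivity) hm.le⟩
  exact ⟨_, Nat.find hex, rfl, Nat.find_spec hex, fun l hl => Nat.find_min hex hl⟩

/-- The last rejected trial must exceed `a`; the value 1 covers the case without rejections. -/
theorem IsArmijoStep.lower_bound {ψ : Y → ℝ} {σ ζ a α : ℝ} {y Δ : Y} (hζ0 : 0 < ζ)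
    (h : ∀ α, 0 ≤ α → α ≤ a → SufficientDecrease ψ σ y Δ α)
    (hα : IsArmijoStep ψ σ ζ y Δ α) : min 1 (ζ * a) ≤ α := by
  obtain ⟨m, rfl, -, hm⟩ := hα
  cases m with
  | zero => simp
  | succ m =>
    have h1 : a < ζ ^ m := by
      by_contra! hle
      exact hm m (Nat.lt_succ_self m) (h _ (by positivity) hle)
    rw [pow_succ, mul_comm (ζ ^ m)]
    exact (min_le_right _ _).trans (mul_le_mul_of_nonneg_left h1.le hζ0.le)

theorem IsArmijoStep.mem_Ioc {ψ : Y → ℝ} {σ ζ α : ℝ} {y Δ : Y} (hζ0 : 0 < ζ) (hζ1 : ζ < 1)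
    (hα : IsArmijoStep ψ σ ζ y Δ α) : α ∈ Set.Ioc (0 : ℝ) 1 := by
  obtain ⟨m, rfl, -, -⟩ := hα
  exact ⟨by positivity, pow_le_one₀ hζ0.le hζ1.le⟩

theorem IsArmijoStep.sufficientDecrease {ψ : Y → ℝ} {σ ζ α : ℝ} {y Δ : Y}
    (hα : IsArmijoStep ψ σ ζ y Δ α) : SufficientDecrease ψ σ y Δ α := by
  obtain ⟨m, rfl, h, -⟩ := hα
  exact h

variable [FiniteDimensional ℝ Y] {ψ : Y → ℝ} {S : Set Y}

/-- Global convergence of Newton's method with linear constraints and Armijo backtracking. -/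
theorem tendsto_newton_armijo (hψ : ContDiff ℝ 2 ψ)
    (hpos : ∀ y h, h ≠ 0 → 0 < fderiv ℝ (fderiv ℝ ψ) y h h) (hSc : IsClosed S) (hS : Convex ℝ S)
    {η C : ℝ} (hη : 0 < η) (hcoer : ∀ y ∈ S, η * ‖y‖ - C ≤ ψ y)
    {x : Y} (hx : x ∈ S) (hmin : ∀ z ∈ S, z ≠ x → ψ x < ψ z)
    {σ ζ : ℝ} (hσ0 : 0 < σ) (hσ1 : σ < 1) (hζ0 : 0 < ζ) (hζ1 : ζ < 1)
    {y Δ : ℕ → Y} {α : ℕ → ℝ} (h0 : y 0 ∈ S) (hΔ : ∀ k, IsNewtonDirection ψ S (y k) (Δ k))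
    (hα : ∀ k, IsArmijoStep ψ σ ζ (y k) (Δ k) (α k)) (hupd : ∀ k, y (k + 1) = y k + α k • Δ k) :
    (∀ k, y k ∈ S) ∧ Tendsto y atTop (𝓝 x) := by
  have hmem : ∀ k, y k ∈ S := fun k => by
    induction k with
    | zero => exact h0
    | succ k ih =>
      have h1 := (hα k).mem_Ioc hζ0 hζ1
      rw [hupd]
      simpa using hS.add_smul_sub_mem ih (hΔ k).1 ⟨h1.1.le, h1.2⟩
  refine ⟨hmem, ?_⟩
  have hcurv : ∀ y h, 0 ≤ fderiv ℝ (fderiv ℝ ψ) y h h := fun y h => by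
    rcases eq_or_ne h 0 with rfl | hh
    · simp
    · exact (hpos y h hh).le
  have hslope : ∀ k, fderiv ℝ ψ (y k) (Δ k) ≤ 0 := fun k => by
    linarith [(hΔ k).curvature_add_slope_nonpos hS (hmem k), hcurv (y k) (Δ k)]
  have hdec : ∀ k, ψ (y (k + 1)) ≤ ψ (y k) + σ * α k * fderiv ℝ ψ (y k) (Δ k) := fun k => by
    have := (hα k).sufficientDecrease
    unfold SufficientDecrease at this
    rw [hupd]; linarith
  have hanti : Antitone fun k => ψ (y k) := antitone_nat_of_succ_le fun k => by
    have h1 := mul_nonneg (mul_nonneg hσ0.le ((hα k).mem_Ioc hζ0 hζ1).1.le)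
      (neg_nonneg.2 (hslope k))
    linarith [hdec k]
  set K := {z | z ∈ S ∧ ψ z ≤ ψ (y 0)} with hKdef
  have hK : IsCompact K := isCompact_sublevel hψ.continuous hη hcoer hSc _
  have hyK : ∀ k, y k ∈ K := fun k => ⟨hmem k, hanti (Nat.zero_le k)⟩
  have hxle : ∀ z ∈ S, ψ x ≤ ψ z := fun z hz => by
    rcases eq_or_ne z x with rfl | h
    · exact le_rfl
    · exact (hmin z hz h).le
  obtain ⟨a, ha, hdecr⟩ :=
    exists_uniform_sufficientDecrease hψ hpos hS hK (fun z hz => hz.1) hσ1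
  set β := min 1 (ζ * a) with hβdef
  have hβ : 0 < β := lt_min one_pos (mul_pos hζ0 ha)
  have hβle : ∀ k, β ≤ α k := fun k => (hα k).lower_bound hζ0 (hdecr _ (hyK k) _ (hΔ k))
  have hbdd : BddBelow (Set.range fun k => ψ (y k)) :=
    ⟨ψ x, by rintro _ ⟨k, rfl⟩; exact hxle _ (hmem k)⟩
  set l := ⨅ k, ψ (y k)
  have hlim : Tendsto (fun k => ψ (y k)) atTop (𝓝 l) := tendsto_atTop_ciInf hanti hbdd
  have hlim' : Tendsto (fun k => ψ (y (k + 1))) atTop (𝓝 l) :=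
    hlim.comp (tendsto_add_atTop_nat 1)
  -- Since step sizes are at least `β`, the slopes are controlled by successive decreases of `ψ`,
  -- which tend to zero.
  have hsl : ∀ k, -fderiv ℝ ψ (y k) (Δ k) ≤ (ψ (y k) - ψ (y (k + 1))) / (σ * β) := fun k => by
    rw [le_div_iff₀ (by positivity)]
    have h1 := mul_le_mul_of_nonneg_left (hβle k) (mul_nonneg hσ0.le (neg_nonneg.2 (hslope k)))
    linarith [hdec k]
  obtain ⟨M, hM⟩ := hK.exists_bound_of_continuousOn
    (f := fun z => fderiv ℝ (fderiv ℝ ψ) z (x - z) (x - z)) (by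
      have hD : ContDiff ℝ 1 (fderiv ℝ ψ) := hψ.fderiv_right (by norm_num)
      have hH : Continuous (fderiv ℝ (fderiv ℝ ψ)) := hD.continuous_fderiv one_ne_zero
      fun_prop)
  -- The model is bounded below by the slope, because curvature is nonnegative, and above by
  -- `model_le`; then `k` tends to infinity.
  have hgap : ∀ t ∈ Set.Icc (0 : ℝ) 1, t * (l - ψ x) ≤ t ^ 2 / 2 * M := fun t ht => by
    have h1 : ∀ k, t * (ψ (y k) - ψ x) - (ψ (y k) - ψ (y (k + 1))) / (σ * β)
        ≤ t ^ 2 / 2 * M := fun k => by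
      have h2 := (hΔ k).model_le hψ hpos hS hx (hmem k) ht
      have h3 : t ^ 2 / 2 * fderiv ℝ (fderiv ℝ ψ) (y k) (x - y k) (x - y k) ≤ t ^ 2 / 2 * M :=
        mul_le_mul_of_nonneg_left ((le_abs_self _).trans (hM _ (hyK k))) (by positivity)
      unfold newtonModel at h2
      linarith [hcurv (y k) (Δ k), hsl k]
    have h2 : Tendsto (fun k => t * (ψ (y k) - ψ x) - (ψ (y k) - ψ (y (k + 1))) / (σ * β)) atTop
        (𝓝 (t * (l - ψ x) - (l - l) / (σ * β))) :=
      ((hlim.sub_const _).const_mul t).sub ((hlim.sub hlim').div_const _)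
    have h3 := le_of_tendsto' h2 h1
    simpa using h3
  have hl : l ≤ ψ x := by
    by_contra! hlt
    have hg : 0 < l - ψ x := sub_pos.2 hlt
    have h1 := hgap 1 ⟨zero_le_one, le_rfl⟩
    have hM0 : 0 < M := by linarith
    have ht : 0 < min 1 ((l - ψ x) / M) := lt_min one_pos (div_pos hg hM0)
    have h2 := hgap _ ⟨ht.le, min_le_left _ _⟩
    have h3 : min 1 ((l - ψ x) / M) * M ≤ l - ψ x := by
      rw [← le_div_iff₀ hM0]; exact min_le_right _ _
    set t := min 1 ((l - ψ x) / M)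
    have h4 := mul_le_mul_of_nonneg_left h3 ht.le
    have h5 := mul_pos ht hg
    nlinarith
  -- In a compact set a unique cluster point is the limit. Any cluster point has value `l ≤ ψ x`,
  -- hence equals `x`.
  refine hK.tendsto_nhds_of_unique_mapClusterPt (Eventually.of_forall hyK) fun z hz hcl => ?_
  by_contra hne
  have h1 : MapClusterPt (ψ z) atTop (fun k => ψ (y k)) :=
    hcl.continuousAt_comp hψ.continuous.continuousAt
  have h2 : ψ z = l := by
    by_contra hne'
    obtain ⟨U, V, hU, hV, hzU, hlV, hUV⟩ := t2_separation hne'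
    have h3 := h1.frequently (hU.mem_nhds hzU)
    obtain ⟨k, hk1, hk2⟩ := (h3.and_eventually (hlim.eventually_mem (hV.mem_nhds hlV))).exists
    exact Set.disjoint_left.1 hUV hk1 hk2
  linarith [hmin z hz.1 hne]

end NewtonMethod

/-! ### Quadratics with logarithmic barriers -/

section LogBarrier

/-- A quadratic function minus `δ` times the sum of the logarithms of finitely many affine
functions. -/
structure LogBarrier (V : Type*) [NormedAddCommGroup V] [NormedSpace ℝ V] (J : Type*) where
  /-- the bilinear form of the quadratic part -/
  B : V →L[ℝ] V →L[ℝ] ℝ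
  /-- the linear part -/
  l : V →L[ℝ] ℝ
  /-- the constant part -/
  c : ℝ
  /-- the linear parts of the slacks -/
  L : J → V →L[ℝ] ℝ
  /-- the constant parts of the slacks -/
  a : J → ℝ
  /-- the barrier parameter -/
  δ : ℝ

namespace LogBarrier

variable {V : Type*} [NormedAddCommGroup V] [NormedSpace ℝ V] {J : Type*}
  (b : LogBarrier V J)

/-- The slack functions. -/
def slack (p : V) (j : J) : ℝ := b.a j + b.L j p

/-- The set where all slacks are positive. -/
def dom : Set V := {p | ∀ j, 0 < b.slack p j}

/-- The quadratic part. -/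
noncomputable def quad (p : V) : ℝ := 1 / 2 * b.B p p + b.l p + b.c

/-- Composition with an affine map. -/
noncomputable def pullback {V' : Type*} [NormedAddCommGroup V'] [NormedSpace ℝ V'] (w : V)
    (T : V' →L[ℝ] V) : LogBarrier V' J where
  B := b.B.bilinearComp T T
  -- Both cross terms appear because `B` is not assumed symmetric.
  l := (b.l + (1 / 2 : ℝ) • (b.B w + b.B.flip w)).comp T
  c := b.quad w
  L := fun j => (b.L j).comp T
  a := b.slack w
  δ := b.δ

section Pullback

variable {V' : Type*} [NormedAddCommGroup V'] [NormedSpace ℝ V'] (w : V) (T : V' →L[ℝ] V)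

theorem slack_pullback (p : V') : (b.pullback w T).slack p = b.slack (w + T p) := by
  funext j
  simp [slack, pullback, add_assoc]

theorem mem_dom_pullback {p : V'} : p ∈ (b.pullback w T).dom ↔ w + T p ∈ b.dom := by
  simp only [dom, slack_pullback, Set.mem_ofPred_eq]

theorem quad_pullback (p : V') : (b.pullback w T).quad p = b.quad (w + T p) := by
  simp [quad, pullback]
  ring

end Pullback

theorem slack_hasFDerivAt (p : V) (j : J) : HasFDerivAt (fun p => b.slack p j) (b.L j) p :=
  (b.L j).hasFDerivAt.const_add _

theorem convex_dom : Convex ℝ b.dom := by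
  intro p hp q hq s t hs ht hst j
  have h1 : b.slack (s • p + t • q) j = s * b.slack p j + t * b.slack q j := by
    simp only [slack, map_add, map_smul, smul_eq_mul]
    linear_combination (-(b.a j)) * hst
  have hpj := hp j
  have hqj := hq j
  rw [h1]
  rcases hs.eq_or_lt with rfl | hs'
  · rw [zero_add] at hst; subst hst; linarith
  · have := mul_pos hs' hpj
    have := mul_nonneg ht hqj.le
    linarith

variable [Fintype J]

/-- The value of the barrier function, meaningful on its domain. -/
noncomputable def val (p : V) : ℝ := b.quad p - b.δ * ∑ j, Real.log (b.slack p j)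

/-- The gradient of the barrier function on its domain. -/
noncomputable def grad (p : V) : V →L[ℝ] ℝ :=
  (1 / 2 : ℝ) • (b.B p + b.B.flip p) + b.l - ∑ j, (b.δ * (b.slack p j)⁻¹) • b.L j

theorem val_pullback {V' : Type*} [NormedAddCommGroup V'] [NormedSpace ℝ V'] (w : V)
    (T : V' →L[ℝ] V) (p : V') : (b.pullback w T).val p = b.val (w + T p) := by
  rw [val, quad_pullback, slack_pullback, val]
  rfl

theorem isOpen_dom : IsOpen b.dom := by
  have : b.dom = ⋂ j, {p | 0 < b.slack p j} := by ext; simp [dom]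
  rw [this]
  refine isOpen_iInter_of_finite fun j => isOpen_lt continuous_const ?_
  exact (b.L j).continuous.const_add _

theorem hasFDerivAt_val {p : V} (hp : p ∈ b.dom) : HasFDerivAt b.val (b.grad p) p := by
  have h1 : HasFDerivAt (fun p => b.B p p) (b.B p + b.B.flip p) p := by
    refine (b.B.hasFDerivAt.clm_apply (hasFDerivAt_id p)).congr_fderiv ?_
    ext h
    simp
  have h2 : HasFDerivAt (fun p => ∑ j, Real.log (b.slack p j))
      (∑ j, (b.slack p j)⁻¹ • b.L j) p :=
    HasFDerivAt.fun_sum fun j _ => (b.slack_hasFDerivAt p j).log (hp j).ne'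
  have h3 := (((h1.const_mul (1 / 2)).add b.l.hasFDerivAt).add_const b.c).sub (h2.const_mul b.δ)
  refine h3.congr_fderiv ?_
  simp [grad, Finset.smul_sum, smul_smul]

theorem hasFDerivAt_grad {p : V} (hp : p ∈ b.dom) : HasFDerivAt b.grad
    ((1 / 2 : ℝ) • (b.B + b.B.flip)
      + ∑ j, (b.δ * ((b.slack p j) ^ 2)⁻¹) • (b.L j).smulRight (b.L j)) p := by
  have h1 : HasFDerivAt (fun p => (1 / 2 : ℝ) • (b.B p + b.B.flip p))
      ((1 / 2 : ℝ) • (b.B + b.B.flip)) p :=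
    ((b.B + b.B.flip).hasFDerivAt (x := p)).const_smul (1 / 2 : ℝ)
  have h2 : HasFDerivAt (fun p => ∑ j, (b.δ * (b.slack p j)⁻¹) • b.L j)
      (∑ j, (b.δ • (-(b.slack p j ^ 2)⁻¹ • b.L j)).smulRight (b.L j)) p := by
    refine HasFDerivAt.fun_sum fun j _ => ?_
    have h3 : HasFDerivAt (fun p => b.δ * (b.slack p j)⁻¹)
        (b.δ • (-(b.slack p j ^ 2)⁻¹ • b.L j)) p :=
      ((hasDerivAt_inv (hp j).ne').comp_hasFDerivAt p (b.slack_hasFDerivAt p j)).const_mul b.δ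
    exact h3.smul_const (b.L j)
  refine ((h1.add_const b.l).sub h2).congr_fderiv ?_
  rw [sub_eq_add_neg, ← Finset.sum_neg_distrib]
  congr 1
  refine Finset.sum_congr rfl fun j _ => ?_
  ext h k
  simp
  ring

theorem contDiffAt_grad {p : V} (hp : p ∈ b.dom) : ContDiffAt ℝ 1 b.grad p := by
  have h1 : ∀ j, ContDiffAt ℝ 1 (fun p => b.slack p j) p := fun j =>
    contDiffAt_const.add (b.L j).contDiff.contDiffAt
  have h2 : ContDiffAt ℝ 1 (fun p => ∑ j, (b.δ * (b.slack p j)⁻¹) • b.L j) p :=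
    ContDiffAt.sum fun j _ => (contDiffAt_const.mul ((h1 j).inv (hp j).ne')).smul contDiffAt_const
  have h3 : ContDiffAt ℝ 1 (fun p => (1 / 2 : ℝ) • (b.B p + b.B.flip p) + b.l) p := by fun_prop
  exact h3.sub h2

/-- The second derivative of the barrier function at `p` along `h`. -/
noncomputable def curvature (p h : V) : ℝ :=
  b.B h h + b.δ * ∑ j, (b.L j h / b.slack p j) ^ 2

theorem fderiv_grad_apply {p : V} (hp : p ∈ b.dom) (h : V) :
    fderiv ℝ b.grad p h h = b.curvature p h := by
  rw [(b.hasFDerivAt_grad hp).fderiv]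
  simp only [curvature, Finset.mul_sum, _root_.add_apply, _root_.smul_apply, smul_eq_mul,
    ContinuousLinearMap.flip_apply, _root_.sum_apply,
    ContinuousLinearMap.smulRight_apply]
  congr 1
  · ring
  · exact Finset.sum_congr rfl fun j _ => by rw [div_pow, div_eq_mul_inv]; ring

theorem le_curvature (hδ : 0 < b.δ) (p h : V) : b.B h h ≤ b.curvature p h :=
  le_add_of_nonneg_right (mul_nonneg hδ.le (Finset.sum_nonneg fun _ _ => sq_nonneg _))

/-- Directions in which the quadratic part is flat are seen by the barrier as soon as one slack
varies along them. -/
theorem curvature_pos (hδ : 0 < b.δ) {p h : V} (hp : p ∈ b.dom) (hB : 0 ≤ b.B h h)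
    (h0 : b.B h h = 0 → ∃ j, b.L j h ≠ 0) : 0 < b.curvature p h := by
  rcases hB.eq_or_lt with h1 | h1
  · obtain ⟨j, hj⟩ := h0 h1.symm
    refine add_pos_of_nonneg_of_pos hB (mul_pos hδ ?_)
    exact Finset.sum_pos' (fun _ _ => sq_nonneg _)
      ⟨j, Finset.mem_univ j, sq_pos_of_ne_zero (div_ne_zero hj (hp j).ne')⟩
  · exact h1.trans_le (b.le_curvature hδ p h)

/-- From `log (τ * u) ≤ τ * u - 1`, with `τ` so small that `τ * ‖L‖ ≤ ε`. -/
theorem exists_log_le {V : Type*} [NormedAddCommGroup V] [NormedSpace ℝ V] (a : ℝ) (L : V →L[ℝ] ℝ)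
    {ε : ℝ} (hε : 0 < ε) : ∃ C, ∀ p, 0 < a + L p → Real.log (a + L p) ≤ ε * ‖p‖ + C := by
  set τ := ε / (‖L‖ + 1) with hτ
  have hL : 0 < ‖L‖ + 1 := by positivity
  have hτ0 : 0 < τ := div_pos hε hL
  refine ⟨τ * |a| - 1 - Real.log τ, fun p hp => ?_⟩
  have h1 := Real.log_le_sub_one_of_pos (mul_pos hτ0 hp)
  rw [Real.log_mul hτ0.ne' hp.ne'] at h1
  have h2 : a + L p ≤ |a| + ‖L‖ * ‖p‖ :=
    add_le_add (le_abs_self a) ((le_abs_self _).trans (L.le_opNorm p))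
  have h3 : τ * (‖L‖ * ‖p‖) ≤ ε * ‖p‖ := by
    have : τ * ‖L‖ ≤ ε := by
      rw [hτ, div_mul_eq_mul_div, div_le_iff₀ hL]
      nlinarith
    rw [← mul_assoc]
    exact mul_le_mul_of_nonneg_right this (norm_nonneg p)
  have h4 := mul_le_mul_of_nonneg_left h2 hτ0.le
  linarith

theorem exists_quad_sub_le_val (hδ : 0 < b.δ) {ε : ℝ} (hε : 0 < ε) :
    ∃ C, ∀ p ∈ b.dom, b.quad p - ε * ‖p‖ - C ≤ b.val p := by
  set τ := ε / (b.δ * (Fintype.card J + 1)) with hτ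
  have hτ0 : 0 < τ := by positivity
  choose C hC using fun j => exists_log_le (b.a j) (b.L j) hτ0
  refine ⟨b.δ * ∑ j, C j, fun p hp => ?_⟩
  have h1 : ∑ j, Real.log (b.slack p j) ≤ Fintype.card J * (τ * ‖p‖) + ∑ j, C j := by
    refine (Finset.sum_le_sum fun j _ => hC j p (hp j)).trans ?_
    rw [Finset.sum_add_distrib]
    simp
  have h2 : b.δ * (Fintype.card J * (τ * ‖p‖)) ≤ ε * ‖p‖ := by
    have : b.δ * (Fintype.card J * τ) ≤ ε := by
      have h3 : b.δ * ((Fintype.card J + 1) * τ) = ε := by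
        rw [hτ]; field_simp
      nlinarith
    calc b.δ * (Fintype.card J * (τ * ‖p‖)) = b.δ * (Fintype.card J * τ) * ‖p‖ := by ring
      _ ≤ _ := mul_le_mul_of_nonneg_right this (norm_nonneg p)
  have h3 := mul_le_mul_of_nonneg_left h1 hδ.le
  unfold val
  linarith

/-- A barrier function whose quadratic part grows linearly on its nonempty domain attains its
minimum. -/
theorem exists_minimizer [FiniteDimensional ℝ V] (hδ : 0 < b.δ) (hne : b.dom.Nonempty)
    {η C : ℝ} (hη : 0 < η) (hcoer : ∀ p ∈ b.dom, η * ‖p‖ - C ≤ b.quad p) :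
    ∃ p ∈ b.dom, ∀ q ∈ b.dom, b.val p ≤ b.val q := by
  have := FiniteDimensional.proper ℝ V
  obtain ⟨p0, hp0⟩ := hne
  -- Half of the linear growth pays for the logarithms; the other half bounds the sublevel set of
  -- `p0` by `R`.
  obtain ⟨C', hC'⟩ := b.exists_quad_sub_le_val hδ (half_pos hη)
  set R := (b.val p0 + C + C') / (η / 2)
  have hR : ∀ p ∈ b.dom, b.val p ≤ b.val p0 → ‖p‖ ≤ R := fun p hp hle => by
    rw [le_div_iff₀ (half_pos hη)]
    linarith [hcoer p hp, hC' p hp, mul_comm ‖p‖ η]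
  have hcs : ∀ j, Continuous fun p => b.slack p j := fun j => (b.L j).continuous.const_add _
  obtain ⟨S, hS⟩ : ∃ S, ∀ p, ‖p‖ ≤ R → ∀ j, b.slack p j ≤ Real.exp S := by
    refine ⟨Real.log (1 + ∑ j, (|b.a j| + ‖b.L j‖ * |R|)), fun p hp j => ?_⟩
    rw [Real.exp_log (by positivity)]
    have h1 : b.slack p j ≤ |b.a j| + ‖b.L j‖ * |R| := by
      refine add_le_add (le_abs_self _) ((le_abs_self _).trans (((b.L j).le_opNorm p).trans ?_))
      exact mul_le_mul_of_nonneg_left (hp.trans (le_abs_self R)) (norm_nonneg _)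
    have h2 := Finset.single_le_sum (f := fun j => |b.a j| + ‖b.L j‖ * |R|)
      (fun j _ => by positivity) (Finset.mem_univ j)
    exact h1.trans (h2.trans (by linarith))
  set S' := max S 0
  -- On the sublevel set the sum of logarithms is bounded below and each one is at most `S'`. So no
  -- single one falls below `-m`, and the sublevel set keeps away from the boundary of the domain.
  set m := (b.val p0 + C + η * |R|) / b.δ + Fintype.card J * S'
  set K := {p | ‖p‖ ≤ R ∧ ∀ j, Real.exp (-m) ≤ b.slack p j}
  have hKdom : K ⊆ b.dom := fun p hp j => (Real.exp_pos _).trans_le (hp.2 j)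
  have hK : IsCompact K := by
    refine (isCompact_closedBall (0 : V) R).of_isClosed_subset ?_ fun p hp => by
      simpa using hp.1
    have : K = {p | ‖p‖ ≤ R} ∩ ⋂ j, {p | Real.exp (-m) ≤ b.slack p j} := by
      ext p; simp [K]
    rw [this]
    exact (isClosed_le continuous_norm continuous_const).inter
      (isClosed_iInter fun j => isClosed_le continuous_const (hcs j))
  have hsub : ∀ p ∈ b.dom, b.val p ≤ b.val p0 → p ∈ K := fun p hp hle => by
    refine ⟨hR p hp hle, fun j => ?_⟩
    rw [← Real.le_log_iff_exp_le (hp j)]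
    have h1 : ∀ i, Real.log (b.slack p i) ≤ S' := fun i => by
      refine le_trans ?_ (le_max_left S 0)
      rw [Real.log_le_iff_le_exp (hp i)]
      exact hS p (hR p hp hle) i
    classical
    have h2 : ∑ i, Real.log (b.slack p i) ≤ Real.log (b.slack p j) + Fintype.card J * S' := by
      rw [← Finset.add_sum_erase _ _ (Finset.mem_univ j)]
      refine add_le_add_right ((Finset.sum_le_sum fun i _ => h1 i).trans ?_) _
      rw [Finset.sum_const, nsmul_eq_mul]
      refine mul_le_mul_of_nonneg_right ?_ (le_max_right S 0)
      exact_mod_cast Finset.card_le_univ _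
    have h3 := hcoer p hp
    have h4 : 0 ≤ η * ‖p‖ := by positivity
    have h5 : 0 ≤ η * |R| := by positivity
    have h6 : -((b.val p0 + C + η * |R|) / b.δ) ≤ ∑ i, Real.log (b.slack p i) := by
      rw [← neg_div, div_le_iff₀ hδ]
      unfold val at hle ⊢
      linarith
    linarith
  obtain ⟨p, hp, hmin⟩ := hK.exists_isMinOn ⟨p0, hsub p0 hp0 le_rfl⟩
    (fun p hp => (b.hasFDerivAt_val (hKdom hp)).continuousAt.continuousWithinAt)
  refine ⟨p, hKdom hp, fun q hq => ?_⟩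
  rcases le_total (b.val q) (b.val p0) with h | h
  · exact hmin (hsub q hq h)
  · exact le_trans (hmin (hsub p0 hp0 le_rfl)) h

end LogBarrier

/-- The value function of a parametric barrier problem is attained and twice continuously
differentiable. -/
theorem LogBarrier.exists_smooth_minimizers {Y E : Type*} [NormedAddCommGroup Y] [NormedSpace ℝ Y]
    [NormedAddCommGroup E] [NormedSpace ℝ E] [CompleteSpace Y] [FiniteDimensional ℝ E]
    {J : Type*} [Fintype J] (b : LogBarrier (Y × E) J) (hδ : 0 < b.δ)
    (hpos : ∀ p ∈ b.dom, ∀ e : E, e ≠ 0 → 0 < b.curvature p (0, e))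
    (hne : ∀ y, ∃ u, (y, u) ∈ b.dom)
    (hcoer : ∀ y, ∃ η > 0, ∃ C, ∀ u, (y, u) ∈ b.dom → η * ‖u‖ - C ≤ b.quad (y, u)) :
    ∃ us : Y → E, (∀ y, (y, us y) ∈ b.dom) ∧
      (∀ y u, (y, u) ∈ b.dom → b.val (y, us y) ≤ b.val (y, u)) ∧
      ContDiff ℝ 2 (fun y => b.val (y, us y)) ∧
      ∀ y h, ∃ w, fderiv ℝ (fderiv ℝ (fun y => b.val (y, us y))) y h h
        = b.curvature (y, us y) (h, w) := by
  have hex : ∀ y, ∃ u, (y, u) ∈ b.dom ∧ ∀ u', (y, u') ∈ b.dom → b.val (y, u) ≤ b.val (y, u') := by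
    intro y
    set b' := b.pullback (y, 0) (ContinuousLinearMap.inr ℝ Y E)
    have hadd : ∀ u : E, ((y, 0) : Y × E) + ContinuousLinearMap.inr ℝ Y E u = (y, u) := fun u => by
      simp
    have hdom : ∀ u, u ∈ b'.dom ↔ (y, u) ∈ b.dom := fun u => by
      rw [b.mem_dom_pullback, hadd]
    have hval : ∀ u, b'.val u = b.val (y, u) := fun u => by rw [b.val_pullback, hadd]
    obtain ⟨u0, hu0⟩ := hne y
    obtain ⟨η, hη, C, hC⟩ := hcoer y
    obtain ⟨u, hu, hmin⟩ := b'.exists_minimizer hδ ⟨u0, (hdom u0).2 hu0⟩ hη (C := C)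
      fun u hu => by
        rw [b.quad_pullback, hadd]; exact hC u ((hdom u).1 hu)
    refine ⟨u, (hdom u).1 hu, fun u' hu' => ?_⟩
    rw [← hval, ← hval]
    exact hmin u' ((hdom u').2 hu')
  choose us hmem hmin using hex
  have hconv : ∀ y, Convex ℝ {u | (y, u) ∈ b.dom} := fun y => by
    have := (b.pullback (y, 0) (ContinuousLinearMap.inr ℝ Y E)).convex_dom
    convert this using 1
    ext u
    rw [b.mem_dom_pullback]
    simp
  obtain ⟨h1, h2⟩ := contDiff_two_partial_min b.isOpen_dom (fun p hp => b.hasFDerivAt_val hp)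
    (fun p hp => b.contDiffAt_grad hp) hconv
    (fun p hp e he => by rw [b.fderiv_grad_apply hp]; exact hpos p hp e he) hmem hmin
  refine ⟨us, hmem, hmin, h1, fun y h => ?_⟩
  obtain ⟨w, hw⟩ := h2 y h
  exact ⟨w, by rw [hw, b.fderiv_grad_apply (hmem y)]⟩

/-- Sums of barrier functions are coercive if the sum of their quadratic parts is. -/
theorem LogBarrier.exists_coercive_sum {ι Y : Type*} [Fintype ι] [NormedAddCommGroup Y]
    [NormedSpace ℝ Y] {E : ι → Type*} [∀ i, NormedAddCommGroup (E i)] [∀ i, NormedSpace ℝ (E i)]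
    {J : ι → Type*} [∀ i, Fintype (J i)] (b : ∀ i, LogBarrier (Y × E i) (J i))
    (hδ : ∀ i, 0 < (b i).δ) {η C : ℝ} (hη : 0 < η)
    (hcoer : ∀ (y : Y) (u : ∀ i, E i), (∀ i, (y, u i) ∈ (b i).dom) →
      η * (‖y‖ + ∑ i, ‖u i‖) - C ≤ ∑ i, (b i).quad (y, u i)) :
    ∃ η' > 0, ∃ C', ∀ (y : Y) (u : ∀ i, E i), (∀ i, (y, u i) ∈ (b i).dom) →
      η' * ‖y‖ - C' ≤ ∑ i, (b i).val (y, u i) := by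
  -- The variable `y` is charged once per subsystem; this `ε` makes the total charge at most `η /
  -- 2`.
  set ε := η / (2 * (Fintype.card ι + 1)) with hε
  have hε0 : 0 < ε := by positivity
  have hεη : ε * (Fintype.card ι + 1) = η / 2 := by rw [hε]; field_simp
  choose D hD using fun i => (b i).exists_quad_sub_le_val (hδ i) hε0
  refine ⟨η / 2, half_pos hη, C + ∑ i, D i, fun y u hu => ?_⟩
  have h1 : ∑ i, ((b i).quad (y, u i) - ε * (‖y‖ + ‖u i‖) - D i) ≤ ∑ i, (b i).val (y, u i) := by
    refine Finset.sum_le_sum fun i _ => le_trans ?_ (hD i _ (hu i))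
    have : ‖(y, u i)‖ ≤ ‖y‖ + ‖u i‖ := by
      rw [Prod.norm_def]
      exact max_le_add_of_nonneg (norm_nonneg _) (norm_nonneg _)
    have := mul_le_mul_of_nonneg_left this hε0.le
    linarith
  simp only [Finset.sum_sub_distrib, ← Finset.mul_sum, Finset.sum_add_distrib, Finset.sum_const,
    Finset.card_univ, nsmul_eq_mul] at h1
  have h2 := hcoer y u hu
  have hs : 0 ≤ ∑ i, ‖u i‖ := Finset.sum_nonneg fun _ _ => norm_nonneg _
  have hy := norm_nonneg y
  have h3 : (0 : ℝ) ≤ Fintype.card ι := Nat.cast_nonneg _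
  have h4 : ε * ∑ i, ‖u i‖ ≤ η * ∑ i, ‖u i‖ := by
    refine mul_le_mul_of_nonneg_right ?_ hs
    nlinarith
  have h5 : ε * (Fintype.card ι * ‖y‖) ≤ η / 2 * ‖y‖ := by
    rw [← hεη]; nlinarith [mul_nonneg hε0.le hy]
  linarith

end LogBarrier

/-! ### Linear growth from positive definite quadratic parts -/

section Coercivity

/-- Restriction to the affine subspace `w + T p` changes only the linear and constant terms of the
pulled-back form. -/
theorem exists_norm_sub_le_quadratic_affine {V W : Type*} [NormedAddCommGroup V] [NormedSpace ℝ V]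
    [FiniteDimensional ℝ V] [NormedAddCommGroup W] [NormedSpace ℝ W] (B : W →L[ℝ] W →L[ℝ] ℝ)
    (l : W →L[ℝ] ℝ) (w : W) (T : V →L[ℝ] W) (hB : ∀ h, h ≠ 0 → 0 < B (T h) (T h)) :
    ∃ C, ∀ p, ‖p‖ - C ≤ 1 / 2 * B (w + T p) (w + T p) + l (w + T p) := by
  obtain ⟨C, hC⟩ := exists_norm_sub_le_quadratic (B := B.bilinearComp T T)
    (fun h hh => by simpa using hB h hh) ((l + (1 / 2 : ℝ) • (B w + B.flip w)).comp T)
  refine ⟨C - (1 / 2 * B w w + l w), fun p => ?_⟩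
  have := hC p
  simp only [ContinuousLinearMap.bilinearComp_apply, ContinuousLinearMap.comp_apply,
    _root_.add_apply, _root_.smul_apply, smul_eq_mul, ContinuousLinearMap.flip_apply] at this
  simp only [map_add, _root_.add_apply]
  linarith

variable {Y : Type*} [NormedAddCommGroup Y] [NormedSpace ℝ Y]

theorem LogBarrier.exists_coercive_slice {E J : Type*} [NormedAddCommGroup E] [NormedSpace ℝ E]
    [FiniteDimensional ℝ E] (b : LogBarrier (Y × E) J)
    (hB : ∀ e : E, e ≠ 0 → 0 < b.B (0, e) (0, e)) (y : Y) :
    ∃ η > 0, ∃ C, ∀ u, (y, u) ∈ b.dom → η * ‖u‖ - C ≤ b.quad (y, u) := by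
  obtain ⟨C, hC⟩ := exists_norm_sub_le_quadratic_affine b.B b.l (y, 0)
    (ContinuousLinearMap.inr ℝ Y E) (by simpa using hB)
  refine ⟨1, one_pos, C - b.c, fun u _ => ?_⟩
  have := hC u
  simp only [ContinuousLinearMap.inr_apply, Prod.mk_add_mk, add_zero, zero_add] at this
  unfold quad
  linarith

theorem LogBarrier.exists_coercive_sum_quad {ι : Type*} [Fintype ι] [FiniteDimensional ℝ Y]
    {E J : ι → Type*} [∀ i, NormedAddCommGroup (E i)] [∀ i, NormedSpace ℝ (E i)]
    [∀ i, FiniteDimensional ℝ (E i)] (b : ∀ i, LogBarrier (Y × E i) (J i))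
    (hB : ∀ (h : Y) (w : ∀ i, E i), (h ≠ 0 ∨ w ≠ 0) → 0 < ∑ i, (b i).B (h, w i) (h, w i)) :
    ∃ η > 0, ∃ C, ∀ (y : Y) (u : ∀ i, E i),
      η * (‖y‖ + ∑ i, ‖u i‖) - C ≤ ∑ i, (b i).quad (y, u i) := by
  let T : ∀ i, Y × (∀ i, E i) →L[ℝ] Y × E i := fun i =>
    (ContinuousLinearMap.id ℝ Y).prodMap (ContinuousLinearMap.proj i)
  have hT : ∀ i y u, T i (y, u) = (y, u i) := fun i y u => rfl
  obtain ⟨C, hC⟩ := exists_norm_sub_le_quadratic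
    (B := ∑ i, (b i).B.bilinearComp (T i) (T i)) (fun p hp => by
      have h1 : p.1 ≠ 0 ∨ p.2 ≠ 0 := by
        by_contra! h
        exact hp (Prod.ext h.1 h.2)
      simp only [_root_.sum_apply, ContinuousLinearMap.bilinearComp_apply]
      exact hB p.1 p.2 h1) (∑ i, (b i).l.comp (T i))
  -- The factor compares the sum of the norms with the maximum norm of the product space.
  refine ⟨1 / (Fintype.card ι + 1), by positivity, C - ∑ i, (b i).c, fun y u => ?_⟩
  have h1 := hC (y, u)
  have h2 : 1 / (Fintype.card ι + 1 : ℝ) * (‖y‖ + ∑ i, ‖u i‖) ≤ ‖(y, u)‖ := by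
    rw [one_div_mul_eq_div, div_le_iff₀ (by positivity)]
    have h3 : ∑ i, ‖u i‖ ≤ Fintype.card ι * ‖(y, u)‖ := by
      refine (Finset.sum_le_sum fun i _ => (norm_le_pi_norm u i).trans
        (norm_snd_le (y, u))).trans ?_
      simp
    have h4 : ‖y‖ ≤ ‖(y, u)‖ := norm_fst_le (y, u)
    linarith
  simp only [_root_.sum_apply, ContinuousLinearMap.bilinearComp_apply,
    ContinuousLinearMap.comp_apply, hT] at h1
  simp only [quad, Finset.sum_add_distrib, ← Finset.mul_sum]
  linarith

end Coercivity

/-! ### Cost forms and constraint maps of the network program -/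

theorem sumElim_smul {m n : Type*} (c : ℝ) (u : m → ℝ) (v : n → ℝ) :
    Sum.elim (c • u) (c • v) = c • Sum.elim u v := by
  funext j
  rcases j with j | j <;> rfl

namespace NetworkQP

variable {ι : Type*} {ny : ℕ} (P : NetworkQP ι ny)

section Maps

variable (i : ι)

/-- The bilinear form of the cost of subsystem `i`. -/
noncomputable def costForm : ((Fin (P.nx i) → ℝ) × (Fin ny → ℝ)) →L[ℝ]
    ((Fin (P.nx i) → ℝ) × (Fin ny → ℝ)) →L[ℝ] ℝ :=
  (LinearMap.mk₂ ℝ (fun p q : (Fin (P.nx i) → ℝ) × (Fin ny → ℝ) => Sum.elim p.1 p.2 ⬝ᵥ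
      (fromBlocks (P.Hxx i) (P.Hxy i) (P.Hxy i)ᵀ (P.Hyy i) *ᵥ Sum.elim q.1 q.2))
    (fun p p' q => by
      rw [← add_dotProduct, Prod.fst_add, Prod.snd_add, Sum.elim_add_add])
    (fun c p q => by
      rw [← smul_dotProduct, Prod.smul_fst, Prod.smul_snd, sumElim_smul])
    (fun p q q' => by
      rw [← dotProduct_add, ← mulVec_add, Prod.fst_add, Prod.snd_add, Sum.elim_add_add])
    (fun c p q => by
      rw [← dotProduct_smul, ← mulVec_smul, Prod.smul_fst, Prod.smul_snd,
        sumElim_smul])).toContinuousBilinearMap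

/-- The linear part of the cost of subsystem `i`. -/
noncomputable def costLin : ((Fin (P.nx i) → ℝ) × (Fin ny → ℝ)) →L[ℝ] ℝ :=
  (IsLinearMap.mk' (fun p : (Fin (P.nx i) → ℝ) × (Fin ny → ℝ) => P.hx i ⬝ᵥ p.1 + P.hy i ⬝ᵥ p.2)
    ⟨fun p q => by simp only [Prod.fst_add, Prod.snd_add, dotProduct_add]; ring,
     fun c p => by
      simp only [Prod.smul_fst, Prod.smul_snd, dotProduct_smul, smul_add]⟩).toContinuousLinearMap

theorem localCost_eq (x : Fin (P.nx i) → ℝ) (y : Fin ny → ℝ) :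
    P.localCost i x y = 1 / 2 * P.costForm i (x, y) (x, y) + P.costLin i (x, y) := rfl

/-- The linear part of the equality constraints of subsystem `i`. -/
def eqMap : ((Fin (P.nx i) → ℝ) × (Fin ny → ℝ)) →ₗ[ℝ] (Fin (P.na i) → ℝ) :=
  (P.Ax i).mulVecLin.comp (LinearMap.fst ℝ _ _) + (P.Ay i).mulVecLin.comp (LinearMap.snd ℝ _ _)

theorem eqMap_apply (p : (Fin (P.nx i) → ℝ) × (Fin ny → ℝ)) :
    P.eqMap i p = P.Ax i *ᵥ p.1 + P.Ay i *ᵥ p.2 := rfl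

/-- The linear part of the inequality constraints of subsystem `i`. -/
noncomputable def ineqMap : ((Fin (P.nx i) → ℝ) × (Fin ny → ℝ)) →L[ℝ] (Fin (P.nb i) → ℝ) :=
  ((P.Bx i).mulVecLin.comp (LinearMap.fst ℝ _ _)
    + (P.By i).mulVecLin.comp (LinearMap.snd ℝ _ _)).toContinuousLinearMap

theorem ineqMap_apply (p : (Fin (P.nx i) → ℝ) × (Fin ny → ℝ)) :
    P.ineqMap i p = P.Bx i *ᵥ p.1 + P.By i *ᵥ p.2 := rfl

/-- The null space of the equality constraints of subsystem `i`. -/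
abbrev nullSpace : Submodule ℝ ((Fin (P.nx i) → ℝ) × (Fin ny → ℝ)) := LinearMap.ker (P.eqMap i)

variable {P}

/-- Full row rank makes the stacked constraint map surjective, so the equalities can be met with
every inequality slack equal to 1. -/
theorem Regular.exists_slater (h : P.Regular) : ∃ p : (Fin (P.nx i) → ℝ) × (Fin ny → ℝ),
    P.eqMap i p = P.b i ∧ ∀ j, P.ineqMap i p j < P.d i j := by
  set M := fromBlocks (P.Ax i) (P.Ay i) (P.Bx i) (P.By i) with hM
  have hsurj : LinearMap.range M.mulVecLin = ⊤ := by
    apply Submodule.eq_top_of_finrank_eq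
    have := h.full_row_rank i
    rw [Matrix.rank] at this
    simpa using this
  obtain ⟨v, hv⟩ := LinearMap.range_eq_top.1 hsurj (Sum.elim (P.b i) (fun j => P.d i j - 1))
  rw [mulVecLin_apply, hM, fromBlocks_mulVec] at hv
  refine ⟨(v ∘ Sum.inl, v ∘ Sum.inr), ?_, fun j => ?_⟩
  · funext j
    exact congrFun hv (Sum.inl j)
  · have : P.ineqMap i (v ∘ Sum.inl, v ∘ Sum.inr) j = P.d i j - 1 := congrFun hv (Sum.inr j)
    rw [this]
    linarith

theorem Regular.costForm_pos (h : P.Regular) (k : P.nullSpace i) (hk : k ≠ 0) :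
    0 < P.costForm i (k : (Fin (P.nx i) → ℝ) × (Fin ny → ℝ)) k := by
  refine h.reducedHessian_pos i k.1.1 k.1.2 ?_ k.2
  by_contra! h0
  exact hk (Subtype.ext (Prod.ext h0.1 h0.2))

theorem Regular.costForm_nonneg (h : P.Regular) (k : P.nullSpace i) :
    0 ≤ P.costForm i (k : (Fin (P.nx i) → ℝ) × (Fin ny → ℝ)) k := by
  rcases eq_or_ne k 0 with rfl | hk
  · simp
  · exact (h.costForm_pos i k hk).le

/-- The strong convexity inequality at the midpoint of `(x, y)` and its negative: the linear terms
cancel and the cost vanishes at 0. -/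
theorem IsStronglyConvex.sum_costForm_pos [Fintype ι] (h : P.IsStronglyConvex)
    (x : (i : ι) → Fin (P.nx i) → ℝ) (y : Fin ny → ℝ) (h0 : x ≠ 0 ∨ y ≠ 0) :
    0 < ∑ i, P.costForm i (x i, y) (x i, y) := by
  obtain ⟨m, hm, -, hf⟩ := h
  have h1 := hf (x := (x, y)) (Set.mem_univ _) (y := -(x, y)) (Set.mem_univ _)
    (by norm_num : (0 : ℝ) ≤ 1 / 2) (by norm_num : (0 : ℝ) ≤ 1 / 2) (by norm_num)
  have h2 : 0 < ‖(x, y) - -(x, y)‖ := by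
    rw [sub_neg_eq_add, ← two_smul ℝ, norm_smul]
    refine mul_pos (by norm_num) (norm_pos_iff.2 fun h => ?_)
    rw [Prod.mk_eq_zero] at h
    tauto
  have h3 : (1 / 2 : ℝ) • (x, y) + (1 / 2 : ℝ) • -(x, y) = 0 := by
    rw [smul_neg, add_neg_cancel]
  rw [h3] at h1
  have h4 : ∀ i, P.localCost i ((-(x, y)).1 i) (-(x, y)).2
      = 1 / 2 * P.costForm i (x i, y) (x i, y) - P.costLin i (x i, y) := fun i => by
    have : ((-(x, y)).1 i, (-(x, y)).2) = -(x i, y) := rfl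
    rw [localCost_eq, this]
    simp only [map_neg, _root_.neg_apply, neg_neg, sub_eq_add_neg]
  have h5 : ∀ i, P.localCost i ((0 : ((i : ι) → Fin (P.nx i) → ℝ) × (Fin ny → ℝ)).1 i)
      (0 : ((i : ι) → Fin (P.nx i) → ℝ) × (Fin ny → ℝ)).2 = 0 := fun i => by
    have : ((0 : ((i : ι) → Fin (P.nx i) → ℝ) × (Fin ny → ℝ)).1 i,
      (0 : ((i : ι) → Fin (P.nx i) → ℝ) × (Fin ny → ℝ)).2) = 0 := rfl
    rw [localCost_eq, this]
    simp
  simp only [h4, h5, localCost_eq, Finset.sum_const_zero, Finset.sum_add_distrib,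
    Finset.sum_sub_distrib, ← Finset.mul_sum, smul_eq_mul] at h1
  have h6 : 0 < m / 2 * ‖(x, y) - -(x, y)‖ ^ 2 := by positivity
  linarith

theorem IsStronglyConvex.costForm_pos [Fintype ι] (h : P.IsStronglyConvex)
    (x : Fin (P.nx i) → ℝ) (hx : x ≠ 0) : 0 < P.costForm i (x, 0) (x, 0) := by
  classical
  have h1 := h.sum_costForm_pos (Pi.single i x) 0 (Or.inl (by simpa using hx))
  rw [Finset.sum_eq_single i] at h1
  · simpa using h1
  · intro j _ hj
    rw [Pi.single_eq_of_ne hj]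
    exact map_zero _
  · simp

end Maps

/-- If the subproblems are parametric barrier problems with suitable positivity and coercivity,
their value functions are attained and smooth, and the master objective is coercive with positive
definite Hessian. -/
theorem smooth_value_of_barriers [Fintype ι] {R : Relaxation ι ny} {E J : ι → Type*}
    [∀ i, NormedAddCommGroup (E i)] [∀ i, NormedSpace ℝ (E i)] [∀ i, FiniteDimensional ℝ (E i)]
    [∀ i, Fintype (J i)] (b : ∀ i, LogBarrier ((Fin ny → ℝ) × E i) (J i)) (hδ : ∀ i, 0 < (b i).δ)
    (hval : ∀ i y, P.subproblemValues R i y = (fun u => (b i).val (y, u)) '' {u | (y, u) ∈ (b i).dom})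
    (hslice : ∀ i, ∀ p ∈ (b i).dom, ∀ e : E i, e ≠ 0 → 0 < (b i).curvature p (0, e))
    (hne : ∀ i y, ∃ u, (y, u) ∈ (b i).dom)
    (hscoer : ∀ i y, ∃ η > 0, ∃ C, ∀ u, (y, u) ∈ (b i).dom → η * ‖u‖ - C ≤ (b i).quad (y, u))
    (hpos : ∀ (y h : Fin ny → ℝ) (u w : ∀ i, E i), h ≠ 0 → (∀ i, (y, u i) ∈ (b i).dom) →
      0 < ∑ i, (b i).curvature (y, u i) (h, w i))
    (hcoer : ∃ η > 0, ∃ C, ∀ (y : Fin ny → ℝ) (u : ∀ i, E i), (∀ i, (y, u i) ∈ (b i).dom) →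
      η * (‖y‖ + ∑ i, ‖u i‖) - C ≤ ∑ i, (b i).quad (y, u i)) :
    (∀ i y, IsLeast (P.subproblemValues R i y) (P.phi R i y)) ∧
    (∀ i, ContDiff ℝ 2 (P.phi R i)) ∧
    (∀ y h, h ≠ 0 → 0 < ∑ i, fderiv ℝ (fderiv ℝ (P.phi R i)) y h h) ∧
    ∃ η > 0, ∃ C, ∀ y, η * ‖y‖ - C ≤ P.psi R y := by
  choose us hmem hmin hsmooth hhess using fun i =>
    (b i).exists_smooth_minimizers (hδ i) (hslice i) (hne i) (hscoer i)
  have hleast : ∀ i y, IsLeast (P.subproblemValues R i y) ((b i).val (y, us i y)) := fun i y => by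
    rw [hval]
    refine ⟨⟨us i y, hmem i y, rfl⟩, ?_⟩
    rintro _ ⟨u, hu, rfl⟩
    exact hmin i y u hu
  have hphi : ∀ i, P.phi R i = fun y => (b i).val (y, us i y) := fun i =>
    funext fun y => (hleast i y).csInf_eq
  refine ⟨fun i y => ?_, fun i => ?_, fun y h hh => ?_, ?_⟩
  · rw [hphi]; exact hleast i y
  · rw [hphi]; exact hsmooth i
  · choose w hw using fun i => hhess i y h
    simp only [hphi, hw]
    exact hpos y h (fun i => us i y) w hh fun i => hmem i y
  · obtain ⟨η, hη, C, hC⟩ := hcoer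
    obtain ⟨η', hη', C', hC'⟩ := LogBarrier.exists_coercive_sum b hδ hη hC
    refine ⟨η', hη', C', fun y => ?_⟩
    simp only [psi, hphi]
    exact hC' y (fun i => us i y) fun i => hmem i y

end NetworkQP

/-- The dot product as a continuous bilinear form. -/
noncomputable def dotForm (n : ℕ) : (Fin n → ℝ) →L[ℝ] (Fin n → ℝ) →L[ℝ] ℝ :=
  (LinearMap.mk₂ ℝ (fun u v : Fin n → ℝ => u ⬝ᵥ v) add_dotProduct smul_dotProduct dotProduct_add
    (fun c u v => dotProduct_smul c u v)).toContinuousBilinearMap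

theorem real_dotProduct_self_nonneg {n : ℕ} (u : Fin n → ℝ) : 0 ≤ u ⬝ᵥ u :=
  Finset.sum_nonneg fun _ _ => mul_self_nonneg _

theorem norm_le_sum_of_pos {n : ℕ} {v : Fin n → ℝ} (hv : ∀ j, 0 < v j) : ‖v‖ ≤ ∑ j, v j := by
  refine (pi_norm_le_iff_of_nonneg (Finset.sum_nonneg fun j _ => (hv j).le)).2 fun j => ?_
  rw [Real.norm_of_nonneg (hv j).le]
  exact Finset.single_le_sum (fun j _ => (hv j).le) (Finset.mem_univ j)

namespace NetworkQP

variable {ι : Type*} {ny : ℕ} (P : NetworkQP ι ny)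

/-! ### The augmented Lagrangian relaxation as a barrier problem -/

section AugmentedLagrangian

variable (δ ρ : ℝ) (lam : ι → Fin ny → ℝ) (i : ι)

/-- The objective of the augmented Lagrangian subproblem as a function of `(y, (x, z))`, with the
slack variables eliminated. -/
noncomputable def augBarrier :
    LogBarrier ((Fin ny → ℝ) × ((Fin (P.nx i) → ℝ) × (Fin ny → ℝ))) (Fin (P.nb i)) where
  B := (P.costForm i).bilinearComp
      (((ContinuousLinearMap.fst ℝ _ _).comp (.snd ℝ _ _)).prod (.fst ℝ _ _))
      (((ContinuousLinearMap.fst ℝ _ _).comp (.snd ℝ _ _)).prod (.fst ℝ _ _))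
    + ρ • (dotForm ny).bilinearComp
      (.fst ℝ _ _ - (ContinuousLinearMap.snd ℝ _ _).comp (.snd ℝ _ _))
      (.fst ℝ _ _ - (ContinuousLinearMap.snd ℝ _ _).comp (.snd ℝ _ _))
  l := (P.costLin i).comp (((ContinuousLinearMap.fst ℝ _ _).comp (.snd ℝ _ _)).prod (.fst ℝ _ _))
    + (dotForm ny (lam i)).comp (.fst ℝ _ _ - (ContinuousLinearMap.snd ℝ _ _).comp (.snd ℝ _ _))
  c := 0
  L := fun j => -((ContinuousLinearMap.proj j).comp ((P.ineqMap i).comp (.snd ℝ _ _)))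
  a := P.d i
  δ := δ

/-- The augmented Lagrangian subproblem, with the equality constraints eliminated by means of the
particular solution `p`. -/
noncomputable def reducedAugBarrier (p : (Fin (P.nx i) → ℝ) × (Fin ny → ℝ)) :
    LogBarrier ((Fin ny → ℝ) × P.nullSpace i) (Fin (P.nb i)) :=
  (P.augBarrier δ ρ lam i).pullback (0, p)
    ((ContinuousLinearMap.id ℝ _).prodMap (P.nullSpace i).subtypeL)

variable (p : (Fin (P.nx i) → ℝ) × (Fin ny → ℝ))

theorem reducedAugBarrier_B (h : Fin ny → ℝ) (k : P.nullSpace i) :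
    (P.reducedAugBarrier δ ρ lam i p).B (h, k) (h, k)
      = P.costForm i (k.1.1, h) (k.1.1, h) + ρ * ((h - k.1.2) ⬝ᵥ (h - k.1.2)) := rfl

theorem reducedAugBarrier_slack (y : Fin ny → ℝ) (k : P.nullSpace i) :
    (P.reducedAugBarrier δ ρ lam i p).slack (y, k) = P.d i - P.ineqMap i (p + k) := by
  rw [reducedAugBarrier, LogBarrier.slack_pullback]
  rfl

theorem reducedAugBarrier_val (y : Fin ny → ℝ) (k : P.nullSpace i) :
    (P.reducedAugBarrier δ ρ lam i p).val (y, k)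
      = P.localCost i (p + k).1 y + lam i ⬝ᵥ (y - (p + k).2)
        + ρ / 2 * ((y - (p + k).2) ⬝ᵥ (y - (p + k).2))
        - δ * ∑ j, Real.log ((P.d i - P.ineqMap i (p + k)) j) := by
  have h1 : (P.reducedAugBarrier δ ρ lam i p).val (y, k)
      = (P.reducedAugBarrier δ ρ lam i p).quad (y, k)
        - δ * ∑ j, Real.log ((P.reducedAugBarrier δ ρ lam i p).slack (y, k) j) := rfl
  have h2 : (P.reducedAugBarrier δ ρ lam i p).quad (y, k)
      = 1 / 2 * (P.costForm i ((p + k).1, 0 + y) ((p + k).1, 0 + y)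
          + ρ * ((0 + y - (p + k).2) ⬝ᵥ (0 + y - (p + k).2)))
        + (P.costLin i ((p + k).1, 0 + y) + lam i ⬝ᵥ (0 + y - (p + k).2)) + 0 := by
    rw [reducedAugBarrier, LogBarrier.quad_pullback]
    rfl
  rw [h1, h2, reducedAugBarrier_slack, localCost_eq]
  simp only [zero_add]
  ring

theorem subproblemValues_augLag {p : (Fin (P.nx i) → ℝ) × (Fin ny → ℝ)}
    (hp : P.eqMap i p = P.b i) (y : Fin ny → ℝ) :
    P.subproblemValues (.augLag δ ρ lam) i y
      = (fun k => (P.reducedAugBarrier δ ρ lam i p).val (y, k)) ''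
        {k | (y, k) ∈ (P.reducedAugBarrier δ ρ lam i p).dom} := by
  ext c
  constructor
  · rintro ⟨x, s, z, ⟨h1, h2, h3⟩, rfl⟩
    have hk : ((x, z) : (Fin (P.nx i) → ℝ) × (Fin ny → ℝ)) - p ∈ P.nullSpace i := by
      rw [LinearMap.mem_ker, map_sub, hp, eqMap_apply]
      exact h1
    have hs : P.d i - P.ineqMap i (x, z) = s := by
      rw [ineqMap_apply, ← sub_eq_zero, ← neg_eq_zero, ← h2]
      simp only
      abel
    refine ⟨⟨(x, z) - p, hk⟩, fun j => ?_, ?_⟩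
    · rw [reducedAugBarrier_slack]
      simp only [add_sub_cancel, hs]
      exact h3 j
    · simp only [reducedAugBarrier_val, add_sub_cancel, hs]
  · rintro ⟨k, hk, rfl⟩
    refine ⟨(p + k).1, P.d i - P.ineqMap i (p + k), (p + k).2, ⟨?_, ?_, fun j => ?_⟩, ?_⟩
    · rw [← eqMap_apply, map_add, hp, LinearMap.mem_ker.1 k.2]
      simp
    · rw [← ineqMap_apply]
      abel
    · have := hk j
      rwa [reducedAugBarrier_slack] at this
    · exact P.reducedAugBarrier_val δ ρ lam i p y k

end AugmentedLagrangian

/-! ### The ℓ1 relaxation as a barrier problem -/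

section EllOne

variable (δ lbar : ℝ) (i : ι)

/-- The elastic variable `w = z + v - y` of the `ℓ1` subproblem as a function of
`(y, ((x, z), v))`. -/
noncomputable def elasticSlack :
    (Fin ny → ℝ) × (((Fin (P.nx i) → ℝ) × (Fin ny → ℝ)) × (Fin ny → ℝ)) →L[ℝ] (Fin ny → ℝ) :=
  ((ContinuousLinearMap.snd ℝ _ _).comp (.fst ℝ _ _)).comp (.snd ℝ _ _)
    + (ContinuousLinearMap.snd ℝ _ _).comp (.snd ℝ _ _) - ContinuousLinearMap.fst ℝ _ _

/-- The objective of the `ℓ1` subproblem as a function of `(y, ((x, z), v))`, with the slack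
variables and `w = z + v - y` eliminated. -/
noncomputable def ellBarrier :
    LogBarrier ((Fin ny → ℝ) × (((Fin (P.nx i) → ℝ) × (Fin ny → ℝ)) × (Fin ny → ℝ)))
      (Fin (P.nb i) ⊕ (Fin ny ⊕ Fin ny)) where
  B := (P.costForm i).bilinearComp ((ContinuousLinearMap.fst ℝ _ _).comp (.snd ℝ _ _))
    ((ContinuousLinearMap.fst ℝ _ _).comp (.snd ℝ _ _))
  l := (P.costLin i).comp ((ContinuousLinearMap.fst ℝ _ _).comp (.snd ℝ _ _))
    + lbar • (dotForm ny 1).comp ((ContinuousLinearMap.snd ℝ _ _).comp (.snd ℝ _ _)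
      + P.elasticSlack i)
  c := 0
  L := Sum.elim
    (fun j => -((ContinuousLinearMap.proj j).comp
      ((P.ineqMap i).comp ((ContinuousLinearMap.fst ℝ _ _).comp (.snd ℝ _ _)))))
    (Sum.elim
      (fun j => (ContinuousLinearMap.proj j).comp
        ((ContinuousLinearMap.snd ℝ _ _).comp (.snd ℝ _ _)))
      (fun j => (ContinuousLinearMap.proj j).comp (P.elasticSlack i)))
  a := Sum.elim (P.d i) 0
  δ := δ

/-- The `ℓ1` subproblem, with the equality constraints eliminated by means of the particular
solution `p`. -/
noncomputable def reducedEllBarrier (p : (Fin (P.nx i) → ℝ) × (Fin ny → ℝ)) :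
    LogBarrier ((Fin ny → ℝ) × (P.nullSpace i × (Fin ny → ℝ))) (Fin (P.nb i) ⊕ (Fin ny ⊕ Fin ny)) :=
  (P.ellBarrier δ lbar i).pullback (0, (p, 0))
    ((ContinuousLinearMap.id ℝ _).prodMap
      ((P.nullSpace i).subtypeL.prodMap (ContinuousLinearMap.id ℝ _)))

variable (p : (Fin (P.nx i) → ℝ) × (Fin ny → ℝ))

theorem reducedEllBarrier_L_inr_inr (h : Fin ny → ℝ) (k : P.nullSpace i) (v : Fin ny → ℝ)
    (j : Fin ny) :
    (P.reducedEllBarrier δ lbar i p).L (Sum.inr (Sum.inr j)) (h, (k, v)) = (k.1.2 + v - h) j := rfl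

theorem reducedEllBarrier_slack (y : Fin ny → ℝ) (k : P.nullSpace i) (v : Fin ny → ℝ) :
    (P.reducedEllBarrier δ lbar i p).slack (y, (k, v))
      = Sum.elim (P.d i - P.ineqMap i (p + k)) (Sum.elim v ((p + k).2 + v - y)) := by
  have h : (P.reducedEllBarrier δ lbar i p).slack (y, (k, v))
      = (P.ellBarrier δ lbar i).slack (0 + y, (p + k, 0 + v)) := by
    rw [reducedEllBarrier, LogBarrier.slack_pullback]
    rfl
  rw [h, zero_add, zero_add]
  funext j
  rcases j with j | j | j
  · exact (sub_eq_add_neg _ _).symm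
  · exact zero_add _
  · exact zero_add _

theorem mem_dom_reducedEllBarrier {y : Fin ny → ℝ} {k : P.nullSpace i} {v : Fin ny → ℝ} :
    (y, (k, v)) ∈ (P.reducedEllBarrier δ lbar i p).dom
      ↔ (∀ j, 0 < (P.d i - P.ineqMap i (p + k)) j) ∧ (∀ j, 0 < v j)
        ∧ ∀ j, 0 < ((p + k).2 + v - y) j := by
  simp only [LogBarrier.dom, Set.mem_ofPred_eq, reducedEllBarrier_slack, Sum.forall,
    Sum.elim_inl, Sum.elim_inr]

theorem reducedEllBarrier_quad (y : Fin ny → ℝ) (k : P.nullSpace i) (v : Fin ny → ℝ) :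
    (P.reducedEllBarrier δ lbar i p).quad (y, (k, v))
      = 1 / 2 * P.costForm i (p + k) (p + k) + P.costLin i (p + k)
        + lbar * ∑ j, (v j + ((p + k).2 + v - y) j) := by
  have h : (P.reducedEllBarrier δ lbar i p).quad (y, (k, v))
      = 1 / 2 * P.costForm i (p + k) (p + k) + (P.costLin i (p + k)
        + lbar * ((1 : Fin ny → ℝ) ⬝ᵥ (0 + v + ((p + k).2 + (0 + v) - (0 + y))))) + 0 := by
    rw [reducedEllBarrier, LogBarrier.quad_pullback]
    rfl
  rw [h, one_dotProduct]
  simp only [zero_add, add_zero, add_assoc]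
  rfl

theorem reducedEllBarrier_val (y : Fin ny → ℝ) (k : P.nullSpace i) (v : Fin ny → ℝ) :
    (P.reducedEllBarrier δ lbar i p).val (y, (k, v))
      = P.localCost i (p + k).1 (p + k).2 + lbar * ∑ j, (v j + ((p + k).2 + v - y) j)
        - δ * (∑ j, Real.log ((P.d i - P.ineqMap i (p + k)) j) + ∑ j, Real.log (v j)
          + ∑ j, Real.log (((p + k).2 + v - y) j)) := by
  have h1 : (P.reducedEllBarrier δ lbar i p).val (y, (k, v))
      = (P.reducedEllBarrier δ lbar i p).quad (y, (k, v))
        - δ * ∑ j, Real.log ((P.reducedEllBarrier δ lbar i p).slack (y, (k, v)) j) := rfl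
  rw [h1, reducedEllBarrier_quad, reducedEllBarrier_slack, localCost_eq, Fintype.sum_sum_type,
    Fintype.sum_sum_type, add_assoc (∑ j, _)]
  rfl

theorem subproblemValues_ellOne {p : (Fin (P.nx i) → ℝ) × (Fin ny → ℝ)}
    (hp : P.eqMap i p = P.b i) (y : Fin ny → ℝ) :
    P.subproblemValues (.ellOne δ lbar) i y
      = (fun u => (P.reducedEllBarrier δ lbar i p).val (y, u)) ''
        {u | (y, u) ∈ (P.reducedEllBarrier δ lbar i p).dom} := by
  ext c
  constructor
  · rintro ⟨x, s, z, v, w, ⟨h1, h2, h3⟩, hv, hw, h4, rfl⟩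
    have hk : ((x, z) : (Fin (P.nx i) → ℝ) × (Fin ny → ℝ)) - p ∈ P.nullSpace i := by
      rw [LinearMap.mem_ker, map_sub, hp, eqMap_apply]
      exact h1
    have hs : P.d i - P.ineqMap i (x, z) = s := by
      rw [ineqMap_apply, ← sub_eq_zero, ← neg_eq_zero, ← h2]
      simp only
      abel
    have hw' : z + v - y = w := by
      rw [← sub_eq_zero, ← neg_eq_zero, ← h4]
      abel
    refine ⟨(⟨(x, z) - p, hk⟩, v), ?_, ?_⟩
    · refine (P.mem_dom_reducedEllBarrier δ lbar i p).2 ?_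
      simp only [add_sub_cancel, hs, hw']
      exact ⟨h3, hv, hw⟩
    · simp only [reducedEllBarrier_val, add_sub_cancel, hs, hw']
  · rintro ⟨⟨k, v⟩, hk, rfl⟩
    obtain ⟨hs, hv, hw⟩ := (P.mem_dom_reducedEllBarrier δ lbar i p).1 hk
    refine ⟨(p + k).1, P.d i - P.ineqMap i (p + k), (p + k).2, v, (p + k).2 + v - y,
      ⟨?_, ?_, hs⟩, hv, hw, ?_, ?_⟩
    · rw [← eqMap_apply, map_add, hp, LinearMap.mem_ker.1 k.2]
      simp
    · rw [← ineqMap_apply]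
      abel
    · abel
    · exact P.reducedEllBarrier_val δ lbar i p y k v

end EllOne

/-! ### Positivity and coercivity for both relaxations -/

variable {P}

/-- Strong convexity controls all `x i` and `y` only jointly, so positivity in `y` is obtained for
the sum over subsystems. It does not see the copies `z`; these are controlled by the penalty `ρ`. -/
theorem smooth_value_augLag [Fintype ι] (hconv : P.IsStronglyConvex) (hreg : P.Regular)
    {δ ρ : ℝ} (hδ : 0 < δ) (hρ : 0 < ρ) (lam : ι → Fin ny → ℝ) :
    (∀ i y, IsLeast (P.subproblemValues (.augLag δ ρ lam) i y) (P.phi (.augLag δ ρ lam) i y)) ∧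
    (∀ i, ContDiff ℝ 2 (P.phi (.augLag δ ρ lam) i)) ∧
    (∀ y h, h ≠ 0 → 0 < ∑ i, fderiv ℝ (fderiv ℝ (P.phi (.augLag δ ρ lam) i)) y h h) ∧
    ∃ η > 0, ∃ C, ∀ y, η * ‖y‖ - C ≤ P.psi (.augLag δ ρ lam) y := by
  choose p hp hslater using hreg.exists_slater
  set b := fun i => P.reducedAugBarrier δ ρ lam i (p i) with hb
  have hδb : ∀ i, 0 < (b i).δ := fun _ => hδ
  have hB : ∀ i (h : Fin ny → ℝ) (k : P.nullSpace i), (b i).B (h, k) (h, k)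
      = P.costForm i (k.1.1, h) (k.1.1, h) + ρ * ((h - k.1.2) ⬝ᵥ (h - k.1.2)) := fun i h k =>
    P.reducedAugBarrier_B δ ρ lam i (p i) h k
  have hBslice : ∀ i (e : P.nullSpace i), e ≠ 0 → 0 < (b i).B (0, e) (0, e) := fun i e he => by
    rw [hB]
    have h1 := real_dotProduct_self_nonneg (0 - e.1.2)
    rcases eq_or_ne e.1.1 0 with hx | hx
    · have hz : (0 - e.1.2) ≠ 0 := by
        rw [zero_sub, neg_ne_zero]
        exact fun hz => he (Subtype.ext (Prod.ext hx hz))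
      have h2 : 0 < (0 - e.1.2) ⬝ᵥ (0 - e.1.2) :=
        h1.lt_of_ne fun h => hz (dotProduct_self_eq_zero.1 h.symm)
      have h3 : P.costForm i (e.1.1, 0) (e.1.1, 0) = 0 := by
        rw [hx]; exact map_zero _
      rw [h3, zero_add]
      positivity
    · exact add_pos_of_pos_of_nonneg (hconv.costForm_pos i _ hx) (mul_nonneg hρ.le h1)
  have hBsum : ∀ (h : Fin ny → ℝ) (w : ∀ i, P.nullSpace i), (h ≠ 0 ∨ w ≠ 0) →
      0 < ∑ i, (b i).B (h, w i) (h, w i) := fun h w hw => by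
    simp only [hB, Finset.sum_add_distrib]
    have h1 : ∀ i, 0 ≤ ρ * ((h - (w i).1.2) ⬝ᵥ (h - (w i).1.2)) := fun i =>
      mul_nonneg hρ.le (real_dotProduct_self_nonneg _)
    by_cases h0 : (fun i => (w i).1.1) ≠ 0 ∨ h ≠ 0
    · exact add_pos_of_pos_of_nonneg (hconv.sum_costForm_pos (fun i => (w i).1.1) h h0)
        (Finset.sum_nonneg fun i _ => h1 i)
    -- Here `h` and all `x`-parts vanish, so only the `z`-parts remain and the slice estimate
    -- applies.
    · push Not at h0
      obtain ⟨hx, rfl⟩ := h0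
      have hw0 : w ≠ 0 := hw.resolve_left (by simp)
      obtain ⟨i, hi⟩ := Function.ne_iff.1 hw0
      rw [← Finset.sum_add_distrib]
      simp only [← hB]
      refine Finset.sum_pos' (fun j _ => ?_) ⟨i, Finset.mem_univ i, hBslice i _ hi⟩
      rcases eq_or_ne (w j) 0 with hj | hj
      · rw [hj]; exact (map_zero ((b j).B (0, 0))).ge
      · exact (hBslice j _ hj).le
  refine P.smooth_value_of_barriers b hδb (fun i y => P.subproblemValues_augLag δ ρ lam i (hp i) y)
    (fun i q _ e he => (hBslice i e he).trans_le ((b i).le_curvature (hδb i) _ _))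
    (fun i y => ⟨0, fun j => ?_⟩) (fun i => (b i).exists_coercive_slice (hBslice i))
    (fun y h u w hh _ => (hBsum h w (Or.inl hh)).trans_le
      (Finset.sum_le_sum fun i _ => (b i).le_curvature (hδb i) _ _)) ?_
  · rw [hb, reducedAugBarrier_slack]
    simpa using hslater i j
  · obtain ⟨η, hη, C, hC⟩ := LogBarrier.exists_coercive_sum_quad b hBsum
    exact ⟨η, hη, C, fun y u _ => hC y u⟩

/-- The cost grows in `k`, and the ℓ1 term dominates the norms of the positive vectors `v` and `w`.
Growth in `y` follows from `y = z + v - w`; the factor 1/2 is there because `k` and `v` are then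
counted twice. -/
theorem Regular.exists_coercive_ell (hreg : P.Regular) {δ lbar : ℝ} (hl : 0 < lbar) (i : ι)
    (p : (Fin (P.nx i) → ℝ) × (Fin ny → ℝ)) :
    ∃ C, ∀ (y : Fin ny → ℝ) (u : P.nullSpace i × (Fin ny → ℝ)),
      (y, u) ∈ (P.reducedEllBarrier δ lbar i p).dom →
      min 1 lbar / 2 * (‖y‖ + ‖u‖) - C ≤ (P.reducedEllBarrier δ lbar i p).quad (y, u) := by
  obtain ⟨C, hC⟩ := exists_norm_sub_le_quadratic_affine (P.costForm i) (P.costLin i) p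
    (P.nullSpace i).subtypeL (hreg.costForm_pos i)
  set η := min 1 lbar with hη
  have hη0 : 0 < η := lt_min one_pos hl
  refine ⟨C + η / 2 * ‖p‖, ?_⟩
  rintro y ⟨k, v⟩ hu
  obtain ⟨-, hv, hw⟩ := (P.mem_dom_reducedEllBarrier δ lbar i p).1 hu
  rw [reducedEllBarrier_quad, Finset.sum_add_distrib]
  set w := (p + (k : (Fin (P.nx i) → ℝ) × (Fin ny → ℝ))).2 + v - y with hwdef
  have h1 : ‖k‖ - C ≤ 1 / 2 * P.costForm i (p + k) (p + k) + P.costLin i (p + k) := hC k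
  have h2 := norm_le_sum_of_pos hv
  have h3 := norm_le_sum_of_pos hw
  have h4 : ‖y‖ ≤ ‖p‖ + ‖k‖ + ‖v‖ + ‖w‖ := by
    have : y = (p + (k : (Fin (P.nx i) → ℝ) × (Fin ny → ℝ))).2 + v - w := by
      rw [hwdef]; abel
    rw [this]
    refine (norm_sub_le _ _).trans (add_le_add_left ((norm_add_le _ _).trans
      (add_le_add_left ((norm_snd_le _).trans (norm_add_le _ _)) _)) _)
  have h5 : ‖(k, v)‖ ≤ ‖k‖ + ‖v‖ := by
    rw [Prod.norm_def]
    exact max_le_add_of_nonneg (norm_nonneg _) (norm_nonneg _)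
  have h6 : η * ‖k‖ ≤ ‖k‖ := mul_le_of_le_one_left (norm_nonneg _) (min_le_left _ _)
  have h7 : η * (‖v‖ + ‖w‖) ≤ lbar * (∑ j, v j + ∑ j, w j) :=
    mul_le_mul (min_le_right _ _) (add_le_add h2 h3) (by positivity) hl.le
  have h8 : η / 2 * (‖y‖ + ‖(k, v)‖) ≤ η / 2 * (‖p‖ + 2 * ‖k‖ + 2 * ‖v‖ + 2 * ‖w‖) :=
    mul_le_mul_of_nonneg_left (by linarith [norm_nonneg w]) (half_pos hη0).le
  linarith

/-- The quadratic part is flat exactly where `k = 0`. There a nonzero `v` moves the slack `v`, and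
for `v = 0` a nonzero `h` moves the slack `w = z + v - y`. -/
theorem smooth_value_ellOne [Fintype ι] (hconv : P.IsStronglyConvex) (hreg : P.Regular)
    {δ lbar : ℝ} (hδ : 0 < δ) (hl : 0 < lbar) :
    (∀ i y, IsLeast (P.subproblemValues (.ellOne δ lbar) i y) (P.phi (.ellOne δ lbar) i y)) ∧
    (∀ i, ContDiff ℝ 2 (P.phi (.ellOne δ lbar) i)) ∧
    (∀ y h, h ≠ 0 → 0 < ∑ i, fderiv ℝ (fderiv ℝ (P.phi (.ellOne δ lbar) i)) y h h) ∧
    ∃ η > 0, ∃ C, ∀ y, η * ‖y‖ - C ≤ P.psi (.ellOne δ lbar) y := by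
  choose p hp hslater using hreg.exists_slater
  set b := fun i => P.reducedEllBarrier δ lbar i (p i) with hb
  have hδb : ∀ i, 0 < (b i).δ := fun _ => hδ
  -- With no subsystems the objective is zero, which is strongly convex only if `y` has no nonzero
  -- values.
  have hne : ∀ h : Fin ny → ℝ, h ≠ 0 → Nonempty ι := fun h hh => by
    by_contra hemp
    rw [not_nonempty_iff] at hemp
    simpa using hconv.sum_costForm_pos 0 h (Or.inr hh)
  have hcurv : ∀ i (q : (Fin ny → ℝ) × (P.nullSpace i × (Fin ny → ℝ))), q ∈ (b i).dom →
      ∀ (h : Fin ny → ℝ) (e : P.nullSpace i × (Fin ny → ℝ)), (h ≠ 0 ∨ e ≠ 0) →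
      0 < (b i).curvature q (h, e) := by
    rintro i q hq h ⟨k, v⟩ hne0
    refine (b i).curvature_pos (hδb i) hq (hreg.costForm_nonneg i k) fun h0 => ?_
    have hk : k = 0 := by
      by_contra hk
      exact (hreg.costForm_pos i k hk).ne' h0
    by_cases hv : v = 0
    · have hh : h ≠ 0 := hne0.resolve_right (by simp [hk, hv])
      obtain ⟨j, hj⟩ := Function.ne_iff.1 hh
      refine ⟨Sum.inr (Sum.inr j), ?_⟩
      rw [hb, reducedEllBarrier_L_inr_inr, hk, hv]
      simpa using hj
    · obtain ⟨j, hj⟩ := Function.ne_iff.1 hv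
      exact ⟨Sum.inr (Sum.inl j), hj⟩
  have hη : 0 < min 1 lbar / 2 := half_pos (lt_min one_pos hl)
  choose C hC using fun i => hreg.exists_coercive_ell (δ := δ) hl i (p i)
  refine P.smooth_value_of_barriers b hδb (fun i y => P.subproblemValues_ellOne δ lbar i (hp i) y)
    (fun i q hq e he => hcurv i q hq 0 e (Or.inr he)) (fun i y => ?_)
    (fun i y => ⟨_, hη, C i, fun u hu => ?_⟩) (fun y h u w hh hu => ?_) ⟨_, hη, ∑ i, C i, ?_⟩
  -- This `v` makes `w = z + v - y` at least 1 in every component.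
  · refine ⟨(0, fun j => |(p i).2 j - y j| + 1), ?_⟩
    rw [hb, mem_dom_reducedEllBarrier]
    refine ⟨fun j => ?_, fun j => by positivity, fun j => ?_⟩
    · simpa using hslater i j
    · simp only [ZeroMemClass.coe_zero, add_zero, Pi.sub_apply, Pi.add_apply]
      linarith [neg_abs_le ((p i).2 j - y j)]
  · have h1 := hC i y u hu
    have h2 := mul_nonneg hη.le (norm_nonneg y)
    linarith
  · obtain ⟨i⟩ := hne h hh
    exact Finset.sum_pos (fun i _ => hcurv i _ (hu i) h (w i) (Or.inl hh)) ⟨i, Finset.mem_univ i⟩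
  · intro y u hu
    have h1 := Finset.sum_le_sum fun i (_ : i ∈ Finset.univ) => hC i y (u i) (hu i)
    refine le_trans ?_ h1
    rw [Finset.sum_sub_distrib, ← Finset.mul_sum, Finset.sum_add_distrib, Finset.sum_const,
      Finset.card_univ, nsmul_eq_mul]
    have h2 : ‖y‖ ≤ Fintype.card ι * ‖y‖ := by
      rcases eq_or_ne y 0 with rfl | hy
      · simp
      · have := hne y hy
        have h3 : (1 : ℝ) ≤ Fintype.card ι := by exact_mod_cast Fintype.card_pos
        exact le_mul_of_one_le_left (norm_nonneg y) h3
    have h3 := mul_le_mul_of_nonneg_left h2 hη.le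
    linarith

theorem smooth_value [Fintype ι] (hconv : P.IsStronglyConvex) (hreg : P.Regular)
    {R : Relaxation ι ny} (hR : R.Admissible) :
    (∀ i y, IsLeast (P.subproblemValues R i y) (P.phi R i y)) ∧
    (∀ i, ContDiff ℝ 2 (P.phi R i)) ∧
    (∀ y h, h ≠ 0 → 0 < ∑ i, fderiv ℝ (fderiv ℝ (P.phi R i)) y h h) ∧
    ∃ η > 0, ∃ C, ∀ y, η * ‖y‖ - C ≤ P.psi R y := by
  cases R with
  | augLag δ ρ lam => exact smooth_value_augLag hconv hreg hR.1 hR.2 lam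
  | ellOne δ lbar => exact smooth_value_ellOne hconv hreg hR.1 hR.2

variable (P)

theorem isClosed_masterFeasible : IsClosed P.masterFeasible := by
  have h1 : Continuous fun y : Fin ny → ℝ => P.Ag *ᵥ y - P.bg :=
    P.Ag.mulVecLin.continuous_of_finiteDimensional.sub continuous_const
  have h2 : Continuous fun y : Fin ny → ℝ => P.Bg *ᵥ y - P.dg :=
    P.Bg.mulVecLin.continuous_of_finiteDimensional.sub continuous_const
  exact (isClosed_eq h1 continuous_const).inter (isClosed_le h2 continuous_const)

theorem convex_masterFeasible : Convex ℝ P.masterFeasible := by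
  rintro y ⟨hy1, hy2⟩ z ⟨hz1, hz2⟩ s t hs ht hst
  rw [sub_eq_zero] at hy1 hz1
  rw [sub_nonpos] at hy2 hz2
  refine ⟨?_, ?_⟩
  · rw [sub_eq_zero, mulVec_add, mulVec_smul, mulVec_smul, hy1, hz1, ← add_smul, hst, one_smul]
  · rw [sub_nonpos, mulVec_add, mulVec_smul, mulVec_smul]
    calc s • P.Bg *ᵥ y + t • P.Bg *ᵥ z ≤ s • P.dg + t • P.dg :=
          add_le_add (smul_le_smul_of_nonneg_left hy2 hs) (smul_le_smul_of_nonneg_left hz2 ht)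
      _ = P.dg := by rw [← add_smul, hst, one_smul]

end NetworkQP
-- The coordination problem as a Newton step, and the main theorem
namespace NetworkQP

variable {ι : Type*} [Fintype ι] {ny : ℕ} {P : NetworkQP ι ny} {R : Relaxation ι ny}

theorem fderiv_psi (hφ : ∀ i, ContDiff ℝ 2 (P.phi R i)) :
    fderiv ℝ (P.psi R) = fun y => ∑ i, fderiv ℝ (P.phi R i) y := by
  funext y
  exact (HasFDerivAt.fun_sum fun i _ =>
    ((hφ i).differentiable (by norm_num) y).hasFDerivAt).fderiv

theorem contDiff_psi (hφ : ∀ i, ContDiff ℝ 2 (P.phi R i)) : ContDiff ℝ 2 (P.psi R) :=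
  ContDiff.sum fun i _ => hφ i

theorem fderiv_fderiv_psi (hφ : ∀ i, ContDiff ℝ 2 (P.phi R i)) (y : Fin ny → ℝ) :
    fderiv ℝ (fderiv ℝ (P.psi R)) y = ∑ i, fderiv ℝ (fderiv ℝ (P.phi R i)) y := by
  rw [fderiv_psi hφ]
  refine (HasFDerivAt.fun_sum fun i _ => ?_).fderiv
  have h : ContDiff ℝ 1 (fderiv ℝ (P.phi R i)) := (hφ i).fderiv_right (by norm_num)
  exact (h.differentiable one_ne_zero y).hasFDerivAt

theorem coordObjective_eq_newtonModel (hφ : ∀ i, ContDiff ℝ 2 (P.phi R i)) (y : Fin ny → ℝ) :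
    P.coordObjective R y = newtonModel (P.psi R) y := by
  funext Δ
  rw [newtonModel, fderiv_fderiv_psi hφ, fderiv_psi hφ, coordObjective, Finset.sum_add_distrib,
    ← Finset.mul_sum]
  simp only [_root_.sum_apply]

theorem isSearchDirection_iff (hφ : ∀ i, ContDiff ℝ 2 (P.phi R i)) (y Δ : Fin ny → ℝ) :
    P.IsSearchDirection R y Δ ↔ IsNewtonDirection (P.psi R) P.masterFeasible y Δ := by
  rw [IsSearchDirection, coordObjective_eq_newtonModel hφ]
  rfl

end NetworkQP

theorem theorem1 {ι : Type*} [Fintype ι] {ny : ℕ} (P : NetworkQP ι ny)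
    (hconv : P.IsStronglyConvex) (hreg : P.Regular)
    (hfeas : P.masterFeasible.Nonempty)
    (R : Relaxation ι ny) (hR : R.Admissible)
    (σ ζ : ℝ) (hσ : σ ∈ Set.Ioo (0 : ℝ) 1) (hζ : ζ ∈ Set.Ioo (0 : ℝ) 1) :
    -- the relaxed subproblems are solvable and their value functions are twice
    -- continuously differentiable
    (∀ i y, IsLeast (P.subproblemValues R i y) (P.phi R i y)) ∧
    (∀ i, ContDiff ℝ 2 (P.phi R i)) ∧
    -- there is exactly one global minimizer of the master problem
    ∃ ystar ∈ P.masterFeasible,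
      (∀ y ∈ P.masterFeasible, y ≠ ystar → P.psi R ystar < P.psi R y) ∧
      -- each step is well defined: unique search direction, finite backtracking
      (∀ y ∈ P.masterFeasible, (∃! Δ, P.IsSearchDirection R y Δ) ∧
        ∀ Δ, P.IsSearchDirection R y Δ → ∃ α, P.IsBacktrackingStep R σ ζ y Δ α) ∧
      -- from every feasible starting point the solver can be run, and it converges to the
      -- minimizer, which it returns if it stops
      ∀ y0 ∈ P.masterFeasible,
        (∃ y Δ α, P.IsRun R σ ζ y0 y Δ α) ∧
        ∀ y Δ α, P.IsRun R σ ζ y0 y Δ α →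
          (∀ k, y k ∈ P.masterFeasible) ∧
          (∀ k, Δ k = 0 → y k = ystar) ∧
          Tendsto y atTop (𝓝 ystar) := by

  obtain ⟨hleast, hφ, hpos', η, hη, C, hcoer⟩ := NetworkQP.smooth_value hconv hreg hR
  refine ⟨hleast, hφ, ?_⟩
  have hψ := NetworkQP.contDiff_psi hφ
  have hpos : ∀ y h, h ≠ 0 → 0 < fderiv ℝ (fderiv ℝ (P.psi R)) y h h := fun y h hh => by
    rw [NetworkQP.fderiv_fderiv_psi hφ]
    simpa using hpos' y h hh
  have hSc := P.isClosed_masterFeasible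
  have hS := P.convex_masterFeasible
  have hcoer' : ∀ y ∈ P.masterFeasible, η * ‖y‖ - C ≤ P.psi R y := fun y _ => hcoer y
  obtain ⟨x, hx, hmin⟩ := exists_minimizer_of_coercive hψ.continuous hη hcoer' hSc hfeas
  have hmin' : ∀ y ∈ P.masterFeasible, y ≠ x → P.psi R x < P.psi R y := fun y hy hne =>
    lt_of_minimizer_of_pos hψ hpos hS hx hmin hy hne
  have hdir : ∀ y ∈ P.masterFeasible, ∃! Δ, P.IsSearchDirection R y Δ := fun y hy => by
    simp only [NetworkQP.isSearchDirection_iff hφ]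
    exact existsUnique_isNewtonDirection hpos hSc hS hy
  have hstep : ∀ y ∈ P.masterFeasible, ∀ Δ, P.IsSearchDirection R y Δ →
      ∃ α, P.IsBacktrackingStep R σ ζ y Δ α := fun y hy Δ hΔ => by
    -- Finite backtracking at one point is the uniform statement on the compact set `{y}`.
    obtain ⟨a, ha, hdec⟩ := exists_uniform_sufficientDecrease hψ hpos hS
      (isCompact_singleton (x := y)) (Set.singleton_subset_iff.2 hy) hσ.2
    exact exists_isArmijoStep ha hζ.1 hζ.2
      (hdec y rfl Δ ((NetworkQP.isSearchDirection_iff hφ y Δ).1 hΔ))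
  refine ⟨x, hx, hmin', fun y hy => ⟨hdir y hy, hstep y hy⟩, fun y0 hy0 => ⟨?_, ?_⟩⟩
  · choose! D hD using fun y hy => (hdir y hy).exists
    choose! A hA using fun y hy => hstep y hy (D y) (hD y hy)
    -- A run is the orbit of `y0` under one step with chosen direction and step size; the choices
    -- are meaningful only on the feasible set, which the orbit never leaves.
    set y : ℕ → Fin ny → ℝ := fun k => (fun z => z + A z • D z)^[k] y0 with hy
    have hupd : ∀ k, y (k + 1) = y k + A (y k) • D (y k) := fun k =>
      Function.iterate_succ_apply' _ k y0
    have hmem : ∀ k, y k ∈ P.masterFeasible := fun k => by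
      induction k with
      | zero => exact hy0
      | succ k ih =>
        have h1 : A (y k) ∈ Set.Ioc (0 : ℝ) 1 :=
          IsArmijoStep.mem_Ioc (ψ := P.psi R) hζ.1 hζ.2 (hA (y k) ih)
        rw [hupd]
        simpa using hS.add_smul_sub_mem ih (hD (y k) ih).1 ⟨h1.1.le, h1.2⟩
    exact ⟨y, fun k => D (y k), fun k => A (y k), rfl, fun k => hD _ (hmem k),
      fun k => hA _ (hmem k), hupd⟩
  · intro y Δ α hrun
    have hnewton : ∀ k, IsNewtonDirection (P.psi R) P.masterFeasible (y k) (Δ k) := fun k =>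
      (NetworkQP.isSearchDirection_iff hφ _ _).1 (hrun.direction k)
    obtain ⟨hmem, hlim⟩ := tendsto_newton_armijo hψ hpos hSc hS hη hcoer' hx hmin' hσ.1 hσ.2 hζ.1
      hζ.2 (by rw [hrun.init]; exact hy0) hnewton hrun.step hrun.update
    refine ⟨hmem, fun k hk => ?_, hlim⟩
    have h0 := hnewton k
    rw [hk] at h0
    exact h0.eq_minimizer hψ hpos hS hx hmin' (hmem k)
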